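/- Let $n\ge 0$ be an integer, let $M\subset\mathbb R^{2n}$ be an open set containing the origin, and write its points as $z=(q,p)=(q_1,\dots,q_n,p_1,\dots,p_n)$, with Euclidean norm $\|z\|$. Let $\omega\in\mathbb R^n$ be non-resonant, i.e. $\sum_{j=1}^n k_j\omega_j\neq 0$ for all $k\in\mathbb Z^n\setminus\{0\}$. Put $I_j(q,p)=\tfrac12(p_j^2+q_j^2)$ and let $$H=H_0+P,\qquad H_0=\sum_{j=1}^n\omega_j I_j,$$ where $P\in C^\infty(M,\mathbb R)$ has a zero of order $3$ at the origin, i.e. $P(z)=O(\|z\|^3)$ as $z\to 0$. Consider in $M$ the Hamiltonian system $\dot q_j=\partial H/\partial p_j$, $\dot p_j=-\partial H/\partial q_j$ ($j=1,\dots,n$). There is a constant $K>0$, depending only on $H$ and $M$, such that for every integer $r\ge 3$ there exist $\varepsilon_0>0$ and $C>0$ with the following property. If $\|(q_0,p_0)\|=\varepsilon<\varepsilon_0$, then the (unique) solution $(q(t),p(t))$ of the system with value $(q_0,p_0)\in M$ at $t=0$ exists in $M$ for all $|t|\le C/\varepsilon^{r-1}$ and satisfies $$\|(q(t),p(t))\|\le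 2\varepsilon\qquad\text{for } |t|\le \frac{C}{\varepsilon^{r-1}}.$$ Furthermore, for each $j=1,\dots,n$, $$|I_j(q(t),p(t))-I_j(q_0,p_0)|\le K\varepsilon^3\qquad\text{for every } t \text{ in the interval of existence with } |t|\le \frac{C}{\varepsilon^{r-2}}.$$ (For $\varepsilon=0$ the time bounds are void: the statement then holds for all $t$.) -/

import Mathlib

open Set Filter Topology Asymptotics

noncomputable section

/-- The space `ℝ^{2n}` of points `z = (q, p)` with its Euclidean norm: `q_j = z (Sum.inl j)` and
`p_j = z (Sum.inr j)`. -/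
abbrev PhaseSpace (n : ℕ) : Type := EuclideanSpace ℝ (Fin n ⊕ Fin n)

/-- The partial derivative `∂H/∂q_j`. -/
def partialQ {n : ℕ} (H : PhaseSpace n → ℝ) (j : Fin n) (z : PhaseSpace n) : ℝ :=
  fderiv ℝ H z (EuclideanSpace.single (Sum.inl j) 1)

/-- The partial derivative `∂H/∂p_j`. -/
def partialP {n : ℕ} (H : PhaseSpace n → ℝ) (j : Fin n) (z : PhaseSpace n) : ℝ :=
  fderiv ℝ H z (EuclideanSpace.single (Sum.inr j) 1)

/-- The Hamiltonian vector field `X_H = (∂H/∂p, -∂H/∂q)`. -/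
def hamiltonianVectorField {n : ℕ} (H : PhaseSpace n → ℝ) (z : PhaseSpace n) : PhaseSpace n :=
  WithLp.toLp 2 (Sum.elim (fun j => partialP H j z) (fun j => -partialQ H j z))

/-- `γ` is a solution on the time set `s` of the Hamiltonian system of `H`, in the phase
space `M`. -/
def IsHamiltonianSolutionOn {n : ℕ} (M : Set (PhaseSpace n)) (H : PhaseSpace n → ℝ)
    (γ : ℝ → PhaseSpace n) (s : Set ℝ) : Prop :=
  MapsTo γ s M ∧ IsIntegralCurveOn γ (fun _ => hamiltonianVectorField H) s

/-- The `j`-th action `I_j = (p_j² + q_j²) / 2`. -/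
def action {n : ℕ} (j : Fin n) (z : PhaseSpace n) : ℝ :=
  (z (Sum.inr j) ^ 2 + z (Sum.inl j) ^ 2) / 2

/-- The harmonic oscillator `H₀ = ∑ ω_j I_j`. -/
def harmonicOscillator {n : ℕ} (ω : Fin n → ℝ) (z : PhaseSpace n) : ℝ :=
  ∑ j, ω j * action j z

/-- The frequency vector `ω` is non-resonant. -/
def NonResonant {n : ℕ} (ω : Fin n → ℝ) : Prop :=
  ∀ k : Fin n → ℤ, k ≠ 0 → ∑ j, (k j : ℝ) * ω j ≠ 0

end

/-! This is Birkhoff's normal form argument, arranged so that the phase space never undergoes a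
change of coordinates: the actions are transported instead of the flow. In the coordinates `ξ = q +
ip`, `η = q - ip`, bracketing with `H₀` is diagonal on monomials, and non-resonance makes its kernel
exactly the span of the monomials in the products `ξ_j η_j`. Non-resonant terms can therefore be
removed degree by degree with truncated Lie series, which gives `h = T Z` up to high order, with `T`
almost canonical and `Z` commuting with every action (`exists_normal_form`). Then `T I_j` almost
commutes with `h` (`exists_approximate_integrals`). Taking for `h` a Taylor polynomial of `H` yields
functions `G_j` with `|G_j - I_j| ≤ A ‖z‖ ^ 3` and drift `O(‖z‖ ^ (r + 2))` along the flow
(`exists_approximate_actions`). Since `‖z‖ ^ 2 = 2 ∑ I_j`, a first-exit argument confines solutions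
to the ball of radius `2ε` while the accumulated drift, of size `ε ^ (r + 2) |t|`, is `O(ε ^ 3)`
(`ApproxActions.norm_le`). Existence comes from a compactly supported modification of `H`, whose
solutions never leave the region where nothing was modified. The constant `K` is independent of `r`
for two reasons. The cubic part of `T I_j` is forced by that of `h`, because no kernel monomial has
odd degree (`sub_mem_ordIdeal_four`), so `A` is fixed once. On the shorter times `ε ^ (2 - r)` the
drift is `O(ε ^ 4)`, which a small `ε₀` absorbs. -/

namespace BirkhoffFormal

noncomputable section

open MvPolynomial

/-! ### The Poisson algebra of polynomials, filtered by order at the origin. -/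

section

variable {ι : Type*}

/-- Complex polynomials in the variables `ξ_j = X (inl j)` and `η_j = X (inr j)`. -/
abbrev Poly (ι : Type*) : Type _ := MvPolynomial (ι ⊕ ι) ℂ

/-- The ideal of the polynomials that vanish at the origin to order at least `m`. -/
abbrev ordIdeal (ι : Type*) (m : ℕ) : Ideal (Poly ι) := idealOfVars (ι ⊕ ι) ℂ ^ m

theorem mem_ordIdeal {m : ℕ} {p : Poly ι} :
    p ∈ ordIdeal ι m ↔ ∀ α : ι ⊕ ι →₀ ℕ, α.degree < m → coeff α p = 0 :=
  mem_pow_idealOfVars_iff' m p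

theorem ordIdeal_anti {a b : ℕ} (h : a ≤ b) {p : Poly ι} (hp : p ∈ ordIdeal ι b) :
    p ∈ ordIdeal ι a :=
  Ideal.pow_le_pow_right h hp

theorem smul_mem_ordIdeal {m : ℕ} (c : ℂ) {p : Poly ι} (hp : p ∈ ordIdeal ι m) :
    c • p ∈ ordIdeal ι m := by
  rw [smul_eq_C_mul]
  exact Ideal.mul_mem_left _ _ hp

theorem pderiv_mem_ordIdeal {m : ℕ} {p : Poly ι} (i : ι ⊕ ι) (hp : p ∈ ordIdeal ι m) :
    pderiv i p ∈ ordIdeal ι (m - 1) := by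
  rw [mem_ordIdeal] at hp ⊢
  intro α hα
  rw [coeff_pderiv, hp, zero_mul]
  rw [map_add, Finsupp.degree_single]
  omega

theorem pderiv_pderiv_comm (i j : ι ⊕ ι) (p : Poly ι) :
    pderiv i (pderiv j p) = pderiv j (pderiv i p) := by
  classical
  ext α
  simp only [coeff_pderiv]
  rcases eq_or_ne i j with rfl | h
  · rfl
  · rw [add_right_comm]
    simp [h, h.symm]
    ring

/-- The polynomial `ξ_j η_j`, twice the `j`-th action. -/
def actionPoly (j : ι) : Poly ι := X (Sum.inl j) * X (Sum.inr j)

theorem actionPoly_mem (j : ι) : actionPoly j ∈ ordIdeal ι 2 := by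
  rw [ordIdeal, pow_two]
  exact Ideal.mul_mem_mul (Ideal.subset_span ⟨_, rfl⟩) (Ideal.subset_span ⟨_, rfl⟩)

variable [Fintype ι]

/-- The Poisson bracket `∑ j, (∂f/∂ξ_j ∂g/∂η_j - ∂f/∂η_j ∂g/∂ξ_j)`. -/
def poisson : Poly ι →ₗ[ℂ] Poly ι →ₗ[ℂ] Poly ι :=
  LinearMap.mk₂ ℂ (fun f g => ∑ j, (pderiv (Sum.inl j) f * pderiv (Sum.inr j) g -
      pderiv (Sum.inr j) f * pderiv (Sum.inl j) g))
    (fun f f' g => by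
      rw [← Finset.sum_add_distrib]
      exact Finset.sum_congr rfl fun j _ => by simp only [map_add]; ring)
    (fun c f g => by
      rw [Finset.smul_sum]
      exact Finset.sum_congr rfl fun j _ => by
        simp only [Derivation.map_smul, smul_mul_assoc, smul_sub])
    (fun f g g' => by
      rw [← Finset.sum_add_distrib]
      exact Finset.sum_congr rfl fun j _ => by simp only [map_add]; ring)
    (fun c f g => by
      rw [Finset.smul_sum]
      exact Finset.sum_congr rfl fun j _ => by
        simp only [Derivation.map_smul, mul_smul_comm, smul_sub])

theorem poisson_apply (f g : Poly ι) :
    poisson f g = ∑ j, (pderiv (Sum.inl j) f * pderiv (Sum.inr j) g -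
      pderiv (Sum.inr j) f * pderiv (Sum.inl j) g) := rfl

theorem poisson_swap (f g : Poly ι) : poisson f g = -poisson g f := by
  rw [poisson_apply, poisson_apply, ← Finset.sum_neg_distrib]
  exact Finset.sum_congr rfl fun j _ => by ring

/-- Each factor loses one order by differentiation. The free index `c` avoids truncated subtraction.
-/
theorem poisson_mem_ordIdeal {a b : ℕ} {f g : Poly ι} (hf : f ∈ ordIdeal ι a)
    (hg : g ∈ ordIdeal ι b) {c : ℕ} (hc : c + 2 ≤ a + b) : poisson f g ∈ ordIdeal ι c := by
  have key : ∀ i k : ι ⊕ ι, pderiv i f * pderiv k g ∈ ordIdeal ι c := fun i k =>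
    ordIdeal_anti (b := (a - 1) + (b - 1)) (by omega) <| by
      rw [ordIdeal, pow_add]
      exact Ideal.mul_mem_mul (pderiv_mem_ordIdeal i hf) (pderiv_mem_ordIdeal k hg)
  exact Ideal.sum_mem _ fun j _ => Ideal.sub_mem _ (key _ _) (key _ _)

theorem poisson_jacobi (χ f g : Poly ι) :
    poisson χ (poisson f g) = poisson (poisson χ f) g + poisson f (poisson χ g) := by
  rw [← sub_eq_zero]
  let A : ι → ι → Poly ι := fun k j =>
    (pderiv (Sum.inl k) χ * pderiv (Sum.inr k) (pderiv (Sum.inl j) f * pderiv (Sum.inr j) g -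
        pderiv (Sum.inr j) f * pderiv (Sum.inl j) g) -
      pderiv (Sum.inr k) χ * pderiv (Sum.inl k) (pderiv (Sum.inl j) f * pderiv (Sum.inr j) g -
        pderiv (Sum.inr j) f * pderiv (Sum.inl j) g)) -
    ((pderiv (Sum.inl k) (pderiv (Sum.inl j) χ * pderiv (Sum.inr j) f -
        pderiv (Sum.inr j) χ * pderiv (Sum.inl j) f) * pderiv (Sum.inr k) g -
      pderiv (Sum.inr k) (pderiv (Sum.inl j) χ * pderiv (Sum.inr j) f -
        pderiv (Sum.inr j) χ * pderiv (Sum.inl j) f) * pderiv (Sum.inl k) g) +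
    (pderiv (Sum.inl k) f * pderiv (Sum.inr k) (pderiv (Sum.inl j) χ * pderiv (Sum.inr j) g -
        pderiv (Sum.inr j) χ * pderiv (Sum.inl j) g) -
      pderiv (Sum.inr k) f * pderiv (Sum.inl k) (pderiv (Sum.inl j) χ * pderiv (Sum.inr j) g -
        pderiv (Sum.inr j) χ * pderiv (Sum.inl j) g)))
  have hA : poisson χ (poisson f g) - (poisson (poisson χ f) g + poisson f (poisson χ g)) =
      ∑ k, ∑ j, A k j := by
    rw [poisson_apply χ (poisson f g), poisson_apply (poisson χ f) g,
      poisson_apply f (poisson χ g), poisson_apply f g, poisson_apply χ f, poisson_apply χ g]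
    simp only [A, map_sum, Finset.mul_sum, Finset.sum_mul, ← Finset.sum_sub_distrib,
      ← Finset.sum_add_distrib]
  -- A single `A k j` need not vanish, but `A k j + A j k` does, so the double sum is added to its
  -- transpose.
  rw [hA, ← add_self_eq_zero]
  nth_rewrite 2 [Finset.sum_comm]
  rw [← Finset.sum_add_distrib]
  refine Finset.sum_eq_zero fun k _ => ?_
  rw [← Finset.sum_add_distrib]
  refine Finset.sum_eq_zero fun j _ => ?_
  simp only [A, map_sub, pderiv_mul]
  -- Mixed derivatives are put in one order, once for each of the three functions.
  rw [pderiv_pderiv_comm (Sum.inl j) (Sum.inl k), pderiv_pderiv_comm (Sum.inl j) (Sum.inr k),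
    pderiv_pderiv_comm (Sum.inr j) (Sum.inl k), pderiv_pderiv_comm (Sum.inr j) (Sum.inr k),
    pderiv_pderiv_comm (Sum.inl j) (Sum.inl k), pderiv_pderiv_comm (Sum.inl j) (Sum.inr k),
    pderiv_pderiv_comm (Sum.inr j) (Sum.inl k), pderiv_pderiv_comm (Sum.inr j) (Sum.inr k),
    pderiv_pderiv_comm (Sum.inl j) (Sum.inl k), pderiv_pderiv_comm (Sum.inl j) (Sum.inr k),
    pderiv_pderiv_comm (Sum.inr j) (Sum.inl k), pderiv_pderiv_comm (Sum.inr j) (Sum.inr k)]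
  ring

/-! ### Truncated Lie series as approximately canonical maps. -/

/-- The Lie monomial `ad_χ^m / m!`. -/
def lieTerm (χ : Poly ι) (m : ℕ) : Poly ι →ₗ[ℂ] Poly ι :=
  (m.factorial : ℂ)⁻¹ • (poisson χ) ^ m

theorem lieTerm_zero (χ f : Poly ι) : lieTerm χ 0 f = f := by simp [lieTerm]

theorem lieTerm_succ (χ f : Poly ι) (m : ℕ) :
    ((m : ℂ) + 1) • lieTerm χ (m + 1) f = poisson χ (lieTerm χ m f) := by
  have h : ((m : ℂ) + 1) ≠ 0 := Nat.cast_add_one_ne_zero m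
  simp only [lieTerm, LinearMap.smul_apply, map_smul, smul_smul, pow_succ', Module.End.mul_apply,
    Nat.factorial_succ, Nat.cast_mul, Nat.cast_add, Nat.cast_one, mul_inv]
  rw [← mul_assoc, mul_inv_cancel₀ h, one_mul]

theorem lieTerm_one (χ f : Poly ι) : lieTerm χ 1 f = poisson χ f := by
  simpa [lieTerm_zero] using lieTerm_succ χ f 0

theorem lieTerm_mem_ordIdeal {c a : ℕ} {χ f : Poly ι} (hχ : χ ∈ ordIdeal ι (c + 2))
    (hf : f ∈ ordIdeal ι a) (m : ℕ) : lieTerm χ m f ∈ ordIdeal ι (a + m * c) := by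
  refine smul_mem_ordIdeal _ ?_
  induction m with
  | zero => simpa using hf
  | succ m ih =>
    rw [pow_succ', Module.End.mul_apply]
    exact poisson_mem_ordIdeal hχ ih (by ring_nf; omega)

/-- By Jacobi, `ad_χ` is a derivation of the bracket; this is its Leibniz rule, where the factor `1
/ m!` absorbs the binomials. -/
theorem lieTerm_poisson (χ f g : Poly ι) (m : ℕ) :
    lieTerm χ m (poisson f g) =
      ∑ ij ∈ Finset.HasAntidiagonal.antidiagonal m, poisson (lieTerm χ ij.1 f) (lieTerm χ ij.2 g) := by
  induction m with
  | zero => simp [lieTerm_zero]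
  | succ m ih =>
    have h : ((m : ℂ) + 1) ≠ 0 := Nat.cast_add_one_ne_zero m
    refine smul_right_injective _ h ?_
    simp only
    rw [lieTerm_succ, ih, map_sum, Finset.smul_sum]
    simp only [poisson_jacobi, ← lieTerm_succ, map_smul, LinearMap.smul_apply]
    -- The weight `m + 1` splits as `i + j`; each half is one of the two sums produced by the
    -- derivation rule.
    have e : ∀ ij ∈ Finset.HasAntidiagonal.antidiagonal (m + 1),
        ((m : ℂ) + 1) • poisson (lieTerm χ ij.1 f) (lieTerm χ ij.2 g) =
        (ij.1 : ℂ) • poisson (lieTerm χ ij.1 f) (lieTerm χ ij.2 g) +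
        (ij.2 : ℂ) • poisson (lieTerm χ ij.1 f) (lieTerm χ ij.2 g) := by
      intro ij hij
      rw [← add_smul]
      congr 1
      exact_mod_cast (Finset.HasAntidiagonal.mem_antidiagonal.1 hij).symm
    rw [Finset.sum_congr rfl e, Finset.sum_add_distrib, Finset.sum_add_distrib]
    refine congrArg₂ (· + ·) ?_ ?_
    · rw [Finset.Nat.sum_antidiagonal_succ]
      simp only [Nat.cast_zero, zero_smul, zero_add, Nat.cast_add, Nat.cast_one]
    · rw [Finset.Nat.sum_antidiagonal_succ']
      simp only [Nat.cast_zero, zero_smul, zero_add, Nat.cast_add, Nat.cast_one]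

/-- The truncated Lie series `∑_{m ≤ N} ad_χ^m / m!`. -/
def lieSeries (χ : Poly ι) (N : ℕ) : Poly ι →ₗ[ℂ] Poly ι :=
  ∑ m ∈ Finset.range (N + 1), lieTerm χ m

theorem lieSeries_apply (χ f : Poly ι) (N : ℕ) :
    lieSeries χ N f = ∑ m ∈ Finset.range (N + 1), lieTerm χ m f := by
  simp [lieSeries]

/-- `T` is tangent to the identity and preserves the Poisson bracket up to order `N`. -/
structure IsCanonicalUpTo (N : ℕ) (T : Poly ι →ₗ[ℂ] Poly ι) : Prop where
  tangent : ∀ {m : ℕ} {f : Poly ι}, f ∈ ordIdeal ι m → T f - f ∈ ordIdeal ι (m + 1)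
  bracket : ∀ {f g : Poly ι}, f ∈ ordIdeal ι 2 → g ∈ ordIdeal ι 2 →
    poisson (T f) (T g) - T (poisson f g) ∈ ordIdeal ι (N + 1)

namespace IsCanonicalUpTo

variable {N : ℕ} {T S : Poly ι →ₗ[ℂ] Poly ι}

theorem map_mem (hT : IsCanonicalUpTo N T) {m : ℕ} {f : Poly ι} (hf : f ∈ ordIdeal ι m) :
    T f ∈ ordIdeal ι m := by
  have := Ideal.add_mem _ (ordIdeal_anti (Nat.le_succ m) (hT.tangent hf)) hf
  rwa [sub_add_cancel] at this

theorem id : IsCanonicalUpTo N (LinearMap.id : Poly ι →ₗ[ℂ] Poly ι) :=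
  ⟨fun _ => by simp, fun _ _ => by simp⟩

theorem comp (hT : IsCanonicalUpTo N T) (hS : IsCanonicalUpTo N S) :
    IsCanonicalUpTo N (T ∘ₗ S) where
  tangent {m f} hf := by
    have := Ideal.add_mem _ (hT.tangent (hS.map_mem hf)) (hS.tangent hf)
    rwa [sub_add_sub_cancel] at this
  bracket {f g} hf hg := by
    have := Ideal.add_mem _ (hT.bracket (hS.map_mem hf) (hS.map_mem hg))
      (hT.map_mem (hS.bracket hf hg))
    rwa [map_sub, sub_add_sub_cancel] at this

end IsCanonicalUpTo

/-- The full series would preserve the bracket. Truncation leaves only the pairs with `i + j > N`,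
and for `f`, `g` of order two such a bracket has order at least `i + j + 2`. -/
theorem isCanonicalUpTo_lieSeries {χ : Poly ι} (hχ : χ ∈ ordIdeal ι 3) (N : ℕ) :
    IsCanonicalUpTo N (lieSeries χ N) where
  tangent {m f} hf := by
    rw [lieSeries_apply, Finset.sum_range_succ', lieTerm_zero, add_sub_cancel_right]
    refine Ideal.sum_mem _ fun k _ => ordIdeal_anti ?_ (lieTerm_mem_ordIdeal (c := 1) hχ hf (k + 1))
    omega
  bracket {f g} hf hg := by
    have h1 : poisson (lieSeries χ N f) (lieSeries χ N g) =
        ∑ ij ∈ Finset.range (N + 1) ×ˢ Finset.range (N + 1),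
          poisson (lieTerm χ ij.1 f) (lieTerm χ ij.2 g) := by
      rw [lieSeries_apply, lieSeries_apply, Finset.sum_product, map_sum poisson,
        LinearMap.sum_apply]
      simp_rw [map_sum]
    have h2 : lieSeries χ N (poisson f g) =
        ∑ ij ∈ Finset.range (N + 1) ×ˢ Finset.range (N + 1) with ij.1 + ij.2 < N + 1,
          poisson (lieTerm χ ij.1 f) (lieTerm χ ij.2 g) := by
      rw [lieSeries_apply]
      simp_rw [lieTerm_poisson]
      rw [Finset.sum_sigma']
      refine Finset.sum_bij' (fun x _ => x.2) (fun ij _ => ⟨ij.1 + ij.2, ij⟩) ?_ ?_ ?_ ?_ ?_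
      · rintro ⟨m, i, j⟩ h
        simp at h ⊢
        omega
      · rintro ⟨i, j⟩ h
        simp at h ⊢
        omega
      · rintro ⟨m, i, j⟩ h
        simp at h ⊢
        exact h.2
      · rintro ⟨i, j⟩ h
        rfl
      · rintro ⟨m, i, j⟩ h
        rfl
    rw [h1, h2, ← Finset.sum_filter_add_sum_filter_not _ (fun ij : ℕ × ℕ => ij.1 + ij.2 < N + 1),
      add_sub_cancel_left]
    refine Ideal.sum_mem _ fun ij hij => ?_
    rw [Finset.mem_filter] at hij
    exact poisson_mem_ordIdeal (lieTerm_mem_ordIdeal (c := 1) hχ hf _)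
      (lieTerm_mem_ordIdeal (c := 1) hχ hg _) (by omega)

/-- What remains is at least quadratic in `χ`, and each bracket with `χ` gains `c` orders. -/
theorem lieSeries_sub_mem {c a : ℕ} {χ f : Poly ι} (hχ : χ ∈ ordIdeal ι (c + 2))
    (hf : f ∈ ordIdeal ι a) (N : ℕ) :
    lieSeries χ (N + 1) f - (f + poisson χ f) ∈ ordIdeal ι (a + 2 * c) := by
  rw [lieSeries_apply, Finset.sum_range_succ', Finset.sum_range_succ', lieTerm_zero,
    lieTerm_one]
  rw [show ∀ x : Poly ι, x + poisson χ f + f - (f + poisson χ f) = x by intro x; ring]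
  refine Ideal.sum_mem _ fun k _ => ordIdeal_anti ?_ (lieTerm_mem_ordIdeal hχ hf (k + 1 + 1))
  gcongr
  omega

/-- The bracket with `ξ_j η_j` is the difference of Euler operators `ξ_j ∂/∂ξ_j - η_j ∂/∂η_j`, which
is diagonal on monomials. -/
theorem coeff_poisson_actionPoly (f : Poly ι) (j : ι) (α : ι ⊕ ι →₀ ℕ) :
    coeff α (poisson f (actionPoly j)) =
      ((α (Sum.inl j) : ℂ) - α (Sum.inr j)) * coeff α f := by
  classical
  have h : poisson f (actionPoly j) = pderiv (Sum.inl j) f * X (Sum.inl j) -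
      pderiv (Sum.inr j) f * X (Sum.inr j) := by
    rw [poisson_apply, Finset.sum_eq_single j]
    · simp [actionPoly]
    · intro k _ hk
      have h1 : pderiv (Sum.inr k) (actionPoly j) = 0 := by
        simp [actionPoly, pderiv_X, hk.symm]
      have h2 : pderiv (Sum.inl k) (actionPoly j) = 0 := by
        simp [actionPoly, pderiv_X, hk.symm]
      rw [h1, h2]
      simp
    · simp
  have key : ∀ i : ι ⊕ ι, coeff α (pderiv i f * X i) = α i * coeff α f := by
    intro i
    rw [coeff_mul_X']
    split_ifs with hi
    · have hi' : Finsupp.single i 1 ≤ α := by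
        rw [Finsupp.single_le_iff]
        exact Nat.one_le_iff_ne_zero.2 (Finsupp.mem_support_iff.1 hi)
      rw [coeff_pderiv, tsub_add_cancel_of_le hi', mul_comm]
      congr 1
      have : 1 ≤ α i := by simpa using hi' i
      simp [Nat.cast_sub this]
    · rw [Finsupp.notMem_support_iff.1 hi]
      simp
  rw [h, coeff_sub, key, key]
  ring

end

/-! ### The homological equation and the formal normal form. -/

section

variable {ι : Type*} [Fintype ι]

/-- The harmonic oscillator `∑ j, ω_j ξ_j η_j / 2`. -/
def oscPoly (ω : ι → ℝ) : Poly ι := ∑ j, ((ω j : ℂ) / 2) • actionPoly j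

/-- The eigenvalue of the bracket with the harmonic oscillator on a monomial. -/
def smallDivisor (ω : ι → ℝ) (α : ι ⊕ ι →₀ ℕ) : ℂ :=
  ∑ j, ((ω j : ℂ) / 2) * ((α (Sum.inl j) : ℂ) - α (Sum.inr j))

theorem oscPoly_mem (ω : ι → ℝ) : oscPoly ω ∈ ordIdeal ι 2 :=
  Ideal.sum_mem _ fun j _ => smul_mem_ordIdeal _ (actionPoly_mem j)

theorem coeff_poisson_oscPoly (ω : ι → ℝ) (f : Poly ι) (α : ι ⊕ ι →₀ ℕ) :
    coeff α (poisson f (oscPoly ω)) = smallDivisor ω α * coeff α f := by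
  simp only [oscPoly, map_sum, map_smul, coeff_sum, coeff_smul, coeff_poisson_actionPoly,
    smul_eq_mul, smallDivisor, Finset.sum_mul, mul_assoc]

theorem poisson_actionPoly_actionPoly (i j : ι) :
    poisson (actionPoly i) (actionPoly j) = 0 := by
  classical
  rw [poisson_apply]
  refine Finset.sum_eq_zero fun k _ => ?_
  by_cases hi : i = k <;> by_cases hj : j = k <;> simp [actionPoly, pderiv_X, hi, hj]
  ring

theorem smallDivisor_eq_zero_iff {n : ℕ} {ω : Fin n → ℝ} (hω : NonResonant ω)
    (α : Fin n ⊕ Fin n →₀ ℕ) :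
    smallDivisor ω α = 0 ↔ ∀ j, α (Sum.inl j) = α (Sum.inr j) := by
  refine ⟨fun h => ?_, fun h => Finset.sum_eq_zero fun j _ => by rw [h j, sub_self, mul_zero]⟩
  by_contra! hne
  obtain ⟨j, hj⟩ := hne
  refine hω (fun j => (α (Sum.inl j) : ℤ) - α (Sum.inr j)) (fun h0 => hj ?_) ?_
  · have := congrFun h0 j
    simp only [Pi.zero_apply] at this
    omega
  · have h2 : ((∑ j, (((α (Sum.inl j) : ℤ) - α (Sum.inr j) : ℤ) : ℝ) * ω j : ℝ) : ℂ) =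
        2 * smallDivisor ω α := by
      rw [smallDivisor, Finset.mul_sum]
      push_cast
      exact Finset.sum_congr rfl fun j _ => by ring
    rw [h, mul_zero] at h2
    exact_mod_cast h2

/-- The operator is diagonal, so `χ` is obtained by dividing coefficients by the small divisors, and
`ζ` collects the kernel monomials. Those have equal exponents in `ξ_j` and `η_j`, hence commute with
every action. -/
theorem exists_homological_solution {n : ℕ} {ω : Fin n → ℝ} (hω : NonResonant ω) {m : ℕ}
    {R : Poly (Fin n)} (hR : R ∈ ordIdeal (Fin n) m) :
    ∃ χ ∈ ordIdeal (Fin n) m, ∃ ζ ∈ ordIdeal (Fin n) m,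
      R = ζ + poisson χ (oscPoly ω) ∧ ∀ j, poisson ζ (actionPoly j) = 0 := by
  classical
  have hsum : ∀ (c : (Fin n ⊕ Fin n →₀ ℕ) → ℂ) (α : Fin n ⊕ Fin n →₀ ℕ),
      coeff α (∑ β ∈ R.support, monomial β (coeff β R * c β)) = coeff α R * c α := by
    intro c α
    simp only [coeff_sum, coeff_monomial, Finset.sum_ite_eq', mem_support_iff, ne_eq, ite_not]
    split_ifs with h
    · simp [h]
    · rfl
  have hmem : ∀ c : (Fin n ⊕ Fin n →₀ ℕ) → ℂ,
      (∑ β ∈ R.support, monomial β (coeff β R * c β)) ∈ ordIdeal (Fin n) m := by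
    intro c
    rw [mem_ordIdeal] at hR ⊢
    intro α hα
    rw [hsum, hR α hα, zero_mul]
  -- The convention `0⁻¹ = 0` removes the resonant monomials from `χ`.
  refine ⟨_, hmem fun β => (smallDivisor ω β)⁻¹, _,
    hmem fun β => if smallDivisor ω β = 0 then 1 else 0, ?_, fun j => ?_⟩
  · ext α
    rw [coeff_add, coeff_poisson_oscPoly, hsum, hsum]
    by_cases h : smallDivisor ω α = 0
    · simp [h]
    · rw [if_neg h]
      field_simp
      ring
  · ext α
    rw [coeff_poisson_actionPoly, hsum, coeff_zero]
    split_ifs with h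
    · rw [(smallDivisor_eq_zero_iff hω α).1 h j, sub_self, zero_mul]
    · simp

/-- If `R = h - T Z` equals `ζ + {χ, H₀}`, then modulo the next order the Lie series of `χ` sends `Z
+ ζ` to `Z + ζ + {χ, H₀} = Z + R`, and `T (Z + R)` agrees with `T Z + R = h`. The accuracy `N` of
the maps is fixed beforehand, so that composing them loses nothing. -/
theorem exists_normal_form {n : ℕ} {ω : Fin n → ℝ} (hω : NonResonant ω) {h : Poly (Fin n)}
    (hh : h - oscPoly ω ∈ ordIdeal (Fin n) 3) (N k : ℕ) :
    ∃ (T : Poly (Fin n) →ₗ[ℂ] Poly (Fin n)) (Z : Poly (Fin n)), IsCanonicalUpTo (N + 1) T ∧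
      (∀ j, poisson Z (actionPoly j) = 0) ∧ Z - oscPoly ω ∈ ordIdeal (Fin n) 3 ∧
      h - T Z ∈ ordIdeal (Fin n) (k + 3) := by
  induction k with
  | zero =>
    refine ⟨LinearMap.id, oscPoly ω, IsCanonicalUpTo.id, fun j => ?_, by simp, by simpa using hh⟩
    simp [oscPoly, LinearMap.sum_apply, poisson_actionPoly_actionPoly]
  | succ k ih =>
    obtain ⟨T, Z, hT, hZ, hZ0, hR⟩ := ih
    obtain ⟨χ, hχ, ζ, hζ, hsol, hζj⟩ := exists_homological_solution hω hR
    have hχ3 : χ ∈ ordIdeal (Fin n) 3 := ordIdeal_anti (by omega) hχ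
    have hE := isCanonicalUpTo_lieSeries hχ3 (N + 1)
    have hZ2 : Z ∈ ordIdeal (Fin n) 2 := by
      have := Ideal.add_mem _ (ordIdeal_anti (by omega : 2 ≤ 3) hZ0) (oscPoly_mem ω)
      rwa [sub_add_cancel] at this
    have hW : Z + ζ ∈ ordIdeal (Fin n) 2 :=
      Ideal.add_mem _ hZ2 (ordIdeal_anti (by omega) hζ)
    refine ⟨T ∘ₗ lieSeries χ (N + 1), Z + ζ, hT.comp hE, fun j => ?_, ?_, ?_⟩
    · rw [map_add, LinearMap.add_apply, hZ, hζj, add_zero]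
    · rw [add_sub_right_comm]
      exact Ideal.add_mem _ hZ0 (ordIdeal_anti (by omega) hζ)
    · have h1 : lieSeries χ (N + 1) (Z + ζ) - (Z + ζ + poisson χ (Z + ζ)) ∈
          ordIdeal (Fin n) (k + 1 + 3) :=
        ordIdeal_anti (by omega) (lieSeries_sub_mem (c := k + 1) hχ hW N)
      have h2 : poisson χ (Z - oscPoly ω) ∈ ordIdeal (Fin n) (k + 1 + 3) :=
        poisson_mem_ordIdeal hχ hZ0 (by omega)
      have h3 : poisson χ ζ ∈ ordIdeal (Fin n) (k + 1 + 3) :=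
        poisson_mem_ordIdeal hχ hζ (by omega)
      have h4 : lieSeries χ (N + 1) (Z + ζ) - (Z + (h - T Z)) ∈ ordIdeal (Fin n) (k + 1 + 3) := by
        have := Ideal.add_mem _ (Ideal.add_mem _ h1 h2) h3
        rw [hsol]
        convert this using 1
        simp only [map_sub, map_add]
        ring
      have h5 := hT.map_mem h4
      have h6 := hT.tangent hR
      have := Ideal.neg_mem_iff _ |>.2 (Ideal.add_mem _ h5 h6)
      convert this using 1
      simp only [LinearMap.comp_apply, map_sub, map_add]
      ring

/-- Formal approximate integrals: deformations of the actions that Poisson commute with `h` up to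
terms of arbitrarily high order. -/
theorem exists_approximate_integrals {n : ℕ} {ω : Fin n → ℝ} (hω : NonResonant ω)
    {h : Poly (Fin n)} (hh : h - oscPoly ω ∈ ordIdeal (Fin n) 3) (N : ℕ) :
    ∃ Φ : Fin n → Poly (Fin n), (∀ j, Φ j - actionPoly j ∈ ordIdeal (Fin n) 3) ∧
      ∀ j, poisson (Φ j) h ∈ ordIdeal (Fin n) N := by
  obtain ⟨T, Z, hT, hZ, hZ0, hR⟩ := exists_normal_form hω hh N N
  refine ⟨fun j => T (actionPoly j), fun j => hT.tangent (actionPoly_mem j), fun j => ?_⟩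
  have hZ2 : Z ∈ ordIdeal (Fin n) 2 := by
    have := Ideal.add_mem _ (ordIdeal_anti (by omega : 2 ≤ 3) hZ0) (oscPoly_mem ω)
    rwa [sub_add_cancel] at this
  have h1 : poisson (T (actionPoly j)) (h - T Z) ∈ ordIdeal (Fin n) N :=
    poisson_mem_ordIdeal (hT.map_mem (actionPoly_mem j)) hR (by omega)
  -- Approximate canonicity compares `{T I_j, T Z}` with `T {I_j, Z} = 0`.
  have h2 := ordIdeal_anti (by omega : N ≤ N + 1 + 1) (hT.bracket (actionPoly_mem j) hZ2)
  rw [poisson_swap (actionPoly j) Z, hZ, neg_zero, map_zero, sub_zero] at h2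
  have := Ideal.add_mem _ h1 h2
  rwa [map_sub, sub_add_cancel] at this

/-- The cubic part of an approximate integral is determined by the cubic part of `h`. -/
theorem sub_mem_ordIdeal_four {n : ℕ} {ω : Fin n → ℝ} (hω : NonResonant ω)
    {h h' : Poly (Fin n)} (hh : h - oscPoly ω ∈ ordIdeal (Fin n) 3)
    (hh' : h' - h ∈ ordIdeal (Fin n) 4) {j : Fin n}
    {Φ Φ' : Poly (Fin n)} (hΦ : Φ - actionPoly j ∈ ordIdeal (Fin n) 3)
    (hΦ' : Φ' - actionPoly j ∈ ordIdeal (Fin n) 3) (hp : poisson Φ h ∈ ordIdeal (Fin n) 4)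
    (hp' : poisson Φ' h' ∈ ordIdeal (Fin n) 4) : Φ' - Φ ∈ ordIdeal (Fin n) 4 := by
  have h3 : Φ' - Φ ∈ ordIdeal (Fin n) 3 := by
    have := Ideal.sub_mem _ hΦ' hΦ
    rwa [sub_sub_sub_cancel_right] at this
  have hΦ2 : Φ' ∈ ordIdeal (Fin n) 2 := by
    have := Ideal.add_mem _ (ordIdeal_anti (by omega : 2 ≤ 3) hΦ') (actionPoly_mem j)
    rwa [sub_add_cancel] at this
  -- At degree three only the quadratic part of the Hamiltonian acts on the difference.
  have h4 : poisson (Φ' - Φ) (oscPoly ω) ∈ ordIdeal (Fin n) 4 := by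
    have e1 : poisson (Φ' - Φ) (h - oscPoly ω) ∈ ordIdeal (Fin n) 4 :=
      poisson_mem_ordIdeal h3 hh (by omega)
    have e2 : poisson Φ' (h' - h) ∈ ordIdeal (Fin n) 4 :=
      poisson_mem_ordIdeal hΦ2 hh' (by omega)
    have := Ideal.sub_mem _ (Ideal.sub_mem _ (Ideal.sub_mem _ hp' hp) e2) e1
    convert this using 1
    simp only [map_sub, LinearMap.sub_apply]
    ring
  rw [mem_ordIdeal] at h3 h4 ⊢
  intro α hα
  rcases lt_or_ge α.degree 3 with hlt | hge
  · exact h3 α hlt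
  · have := h4 α hα
    rw [coeff_poisson_oscPoly] at this
    refine (mul_eq_zero.1 this).resolve_left fun h0 => ?_
    -- A kernel monomial has equal `ξ` and `η` exponents, hence even degree, which cannot be three.
    have hd := (smallDivisor_eq_zero_iff hω α).1 h0
    have hdeg : α.degree = ∑ j, α (Sum.inl j) + ∑ j, α (Sum.inr j) := by
      rw [Finsupp.degree_eq_sum, Fintype.sum_sum_type]
    rw [Finset.sum_congr rfl fun j _ => hd j] at hdeg
    omega

end

/-! ### Polynomials as functions on the phase space, and their order of vanishing. -/

section

variable {n : ℕ}

/-- The complex coordinates `ξ_j = q_j + i p_j` and `η_j = q_j - i p_j`. -/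
def coord : Fin n ⊕ Fin n → (PhaseSpace n →L[ℝ] ℂ)
  | Sum.inl j => Complex.ofRealCLM ∘L EuclideanSpace.proj (Sum.inl j) +
      Complex.I • (Complex.ofRealCLM ∘L EuclideanSpace.proj (Sum.inr j))
  | Sum.inr j => Complex.ofRealCLM ∘L EuclideanSpace.proj (Sum.inl j) -
      Complex.I • (Complex.ofRealCLM ∘L EuclideanSpace.proj (Sum.inr j))

theorem coord_inl (j : Fin n) (z : PhaseSpace n) :
    coord (Sum.inl j) z = z (Sum.inl j) + Complex.I * z (Sum.inr j) := by
  simp [coord]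

theorem coord_inr (j : Fin n) (z : PhaseSpace n) :
    coord (Sum.inr j) z = z (Sum.inl j) - Complex.I * z (Sum.inr j) := by
  simp [coord]

/-- The unit vectors of the phase space. -/
abbrev unitVec (i : Fin n ⊕ Fin n) : PhaseSpace n := EuclideanSpace.single i 1

/-- The Wirtinger functional dual to `coord i`, applied to a real linear map. -/
def wirtFun : Fin n ⊕ Fin n → ((PhaseSpace n →L[ℝ] ℂ) →ₗ[ℂ] ℂ)
  | Sum.inl j =>
    { toFun := fun L => (L (unitVec (Sum.inl j)) - Complex.I * L (unitVec (Sum.inr j))) / 2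
      map_add' := fun L L' => by simp only [add_apply]; ring
      map_smul' := fun c L => by
        simp only [smul_apply, smul_eq_mul, RingHom.id_apply]; ring }
  | Sum.inr j =>
    { toFun := fun L => (L (unitVec (Sum.inl j)) + Complex.I * L (unitVec (Sum.inr j))) / 2
      map_add' := fun L L' => by simp only [add_apply]; ring
      map_smul' := fun c L => by
        simp only [smul_apply, smul_eq_mul, RingHom.id_apply]; ring }

theorem wirtFun_inl (j : Fin n) (L : PhaseSpace n →L[ℝ] ℂ) : wirtFun (Sum.inl j) L =
    (L (unitVec (Sum.inl j)) - Complex.I * L (unitVec (Sum.inr j))) / 2 := rfl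

theorem wirtFun_inr (j : Fin n) (L : PhaseSpace n →L[ℝ] ℂ) : wirtFun (Sum.inr j) L =
    (L (unitVec (Sum.inl j)) + Complex.I * L (unitVec (Sum.inr j))) / 2 := rfl

theorem wirtFun_coord (i k : Fin n ⊕ Fin n) :
    wirtFun i (coord k) = if i = k then 1 else 0 := by
  rcases i with i | i <;> rcases k with k | k <;>
    simp only [wirtFun_inl, wirtFun_inr, coord_inl, coord_inr] <;>
    by_cases h : i = k <;> simp [h, eq_comm]

theorem sum_wirtFun_smul_coord (L : PhaseSpace n →L[ℝ] ℂ) :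
    L = ∑ i, wirtFun i L • coord i := by
  ext v
  have hv : v = ∑ i, v i • unitVec i := by
    ext k
    simp [-Fintype.sum_sum_type, Pi.single_apply]
  have h1 : L v = ∑ i, (v i : ℂ) * L (unitVec i) := by
    conv_lhs => rw [hv]
    simp
  rw [h1, Fintype.sum_sum_type, sum_apply, Fintype.sum_sum_type,
    ← Finset.sum_add_distrib, ← Finset.sum_add_distrib]
  refine Finset.sum_congr rfl fun j _ => ?_
  simp only [smul_apply, smul_eq_mul, wirtFun_inl, wirtFun_inr, coord_inl,
    coord_inr]
  linear_combination ((v (Sum.inr j) : ℂ) * L (unitVec (Sum.inr j))) * Complex.I_sq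

/-- The function on the phase space given by a polynomial in the complex coordinates. -/
def ev (p : Poly (Fin n)) (z : PhaseSpace n) : ℂ := eval (fun i => coord i z) p

theorem ev_add (p q : Poly (Fin n)) : ev (p + q) = ev p + ev q := by
  ext z
  simp [ev]

theorem ev_sub (p q : Poly (Fin n)) : ev (p - q) = ev p - ev q := by
  ext z
  simp [ev]

theorem ev_mul (p q : Poly (Fin n)) : ev (p * q) = ev p * ev q := by
  ext z
  simp [ev]

theorem ev_zero : ev (0 : Poly (Fin n)) = 0 := by
  ext z
  simp [ev]

theorem ev_apply_zero (p : Poly (Fin n)) : ev p 0 = coeff 0 p := by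
  simp only [ev, map_zero, ← constantCoeff_eq]
  rw [eval_zero']

theorem hasFDerivAt_ev (p : Poly (Fin n)) (z : PhaseSpace n) :
    HasFDerivAt (ev p) (∑ i, ev (pderiv i p) z • coord i) z := by
  classical
  induction p using MvPolynomial.induction_on with
  | C a =>
    have : ev (C a : Poly (Fin n)) = fun _ => a := by ext z; simp [ev]
    rw [this]
    refine (hasFDerivAt_const (𝕜 := ℝ) a z).congr_fderiv ?_
    ext v
    simp [ev]
  | add p q hp hq =>
    rw [ev_add]
    refine (hp.add hq).congr_fderiv ?_
    ext v
    simp only [map_add, ev_add, Pi.add_apply, add_apply, sum_apply, smul_apply, smul_eq_mul,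
      add_mul, Finset.sum_add_distrib]
  | mul_X p i hp =>
    have hX : ev (X i : Poly (Fin n)) = coord i := by ext z; simp [ev]
    rw [ev_mul, hX]
    refine (hp.mul (coord i).hasFDerivAt).congr_fderiv ?_
    ext v
    have : ∀ k, ev (pderiv k (p * X i)) z * coord k v =
        (if k = i then ev p z * coord i v else 0) + coord i z * (ev (pderiv k p) z * coord k v) := by
      intro k
      rw [pderiv_mul, ev_add, ev_mul, ev_mul, hX, Pi.add_apply, Pi.mul_apply, Pi.mul_apply,
        pderiv_X]
      by_cases h : k = i
      · subst h
        simp [ev]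
        ring
      · simp [h, ev, Ne.symm h]
        ring
    simp only [add_apply, sum_apply, smul_apply, smul_eq_mul, this]
    rw [Finset.sum_add_distrib, Finset.mul_sum, Finset.sum_ite_eq', if_pos (Finset.mem_univ i)]

theorem contDiff_ev (p : Poly (Fin n)) : ContDiff ℝ (⊤ : ℕ∞) (ev p) := by
  induction p using MvPolynomial.induction_on with
  | C a =>
    have : ev (C a : Poly (Fin n)) = fun _ => a := by ext z; simp [ev]
    rw [this]
    exact contDiff_const
  | add p q hp hq => rw [ev_add]; exact hp.add hq
  | mul_X p i hp =>
    have hX : ev (X i : Poly (Fin n)) = coord i := by ext z; simp [ev]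
    rw [ev_mul, hX]
    exact hp.mul (coord i).contDiff

theorem wirtFun_fderiv_ev (i : Fin n ⊕ Fin n) (p : Poly (Fin n)) (z : PhaseSpace n) :
    wirtFun i (fderiv ℝ (ev p) z) = ev (pderiv i p) z := by
  rw [(hasFDerivAt_ev p z).fderiv, map_sum]
  simp [wirtFun_coord]

/-- Evaluation only sees conjugate values of `ξ` and `η`, so injectivity of polynomial evaluation on
independent variables does not apply directly. Wirtinger derivatives realise `pderiv` and bring each
coefficient down to the constant term. -/
theorem coeff_eq_zero_of_ev_eq_zero (α : Fin n ⊕ Fin n →₀ ℕ) :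
    ∀ p : Poly (Fin n), ev p = 0 → coeff α p = 0 := by
  induction h : α.degree generalizing α with
  | zero =>
    intro p hp
    rw [(Finsupp.degree_eq_zero_iff α).1 h, ← ev_apply_zero, hp, Pi.zero_apply]
  | succ d ih =>
    intro p hp
    obtain ⟨i, hi⟩ : ∃ i, α i ≠ 0 := by
      by_contra! h0
      rw [(Finsupp.degree_eq_zero_iff α).2 (Finsupp.ext h0)] at h
      omega
    obtain ⟨β, rfl⟩ : ∃ β, α = β + Finsupp.single i 1 :=
      ⟨α - Finsupp.single i 1, (tsub_add_cancel_of_le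
        (Finsupp.single_le_iff.2 (Nat.one_le_iff_ne_zero.2 hi))).symm⟩
    have hβ : β.degree = d := by
      rw [map_add, Finsupp.degree_single] at h
      omega
    have h1 := ih β hβ (pderiv i p) (by
      ext z
      rw [← wirtFun_fderiv_ev, hp]
      simp)
    rw [coeff_pderiv] at h1
    exact (mul_eq_zero.1 h1).resolve_right (Nat.cast_add_one_ne_zero _)

theorem isBigO_one_of_continuous {E F : Type*} [NormedAddCommGroup E] [NormedAddCommGroup F]
    {f : E → F} (hf : Continuous f) : f =O[𝓝 0] fun z => ‖z‖ ^ 0 := by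
  simpa using (hf.tendsto 0).isBigO_one ℝ

theorem isBigO_ev {m : ℕ} {p : Poly (Fin n)} (hp : p ∈ ordIdeal (Fin n) m) :
    ev p =O[𝓝 0] fun z => ‖z‖ ^ m := by
  induction m generalizing p with
  | zero => exact isBigO_one_of_continuous (contDiff_ev p).continuous
  | succ m ih =>
    rw [ordIdeal, pow_succ] at hp
    refine Submodule.mul_induction_on hp (fun a ha b hb => ?_) (fun a b ha hb => ?_)
    · rw [ev_mul]
      have : ev b =O[𝓝 0] fun z => ‖z‖ := by
        refine Submodule.span_induction ?_ ?_ (fun x y _ _ hx hy => ?_) (fun c x _ hx => ?_) hb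
        · rintro _ ⟨i, rfl⟩
          have hX : ev (X i : Poly (Fin n)) = coord i := by ext z; simp [ev]
          rw [hX]
          exact ((coord i).isBigO_id _).norm_right
        · rw [ev_zero]
          exact isBigO_zero _ _
        · rw [ev_add]
          exact hx.add hy
        · rw [smul_eq_mul, ev_mul]
          have := (isBigO_one_of_continuous (contDiff_ev c).continuous).mul hx
          simpa [Pi.mul_def] using this
      simpa [pow_succ, Pi.mul_def] using (ih ha).mul this
    · rw [ev_add]
      exact ha.add hb

theorem isBigO_pow_of_le {E F : Type*} [NormedAddCommGroup E] [NormedAddCommGroup F]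
    {f : E → F} {a b : ℕ} (h : a ≤ b)
    (hf : f =O[𝓝 0] fun z => ‖z‖ ^ b) : f =O[𝓝 0] fun z => ‖z‖ ^ a := by
  refine hf.trans (IsBigO.of_bound 1 ?_)
  filter_upwards [Metric.ball_mem_nhds (0 : E) one_pos] with z hz
  rw [mem_ball_zero_iff] at hz
  simpa using pow_le_pow_of_le_one (norm_nonneg z) hz.le h

theorem ev_smul_homogeneousComponent (m : ℕ) (p : Poly (Fin n)) (t : ℝ) (z : PhaseSpace n) :
    ev (homogeneousComponent m p) (t • z) = (t : ℂ) ^ m * ev (homogeneousComponent m p) z := by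
  simp only [ev, map_smul, eval_eq', Finset.mul_sum]
  refine Finset.sum_congr rfl fun α hα => ?_
  have hd : α.degree = m := by
    rw [mem_support_iff, coeff_homogeneousComponent] at hα
    by_contra h
    exact hα (if_neg h)
  simp only [Complex.real_smul, mul_pow, Finset.prod_mul_distrib]
  rw [Finset.prod_pow_eq_pow_sum, ← Finsupp.degree_eq_sum, hd]
  ring

/-- The lowest component scales like `t ^ m` along a ray but is `O(t ^ (m + 1))`, so it vanishes as
a function and then as a polynomial. -/
theorem mem_ordIdeal_of_isBigO {m : ℕ} {p : Poly (Fin n)}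
    (hp : ev p =O[𝓝 0] fun z => ‖z‖ ^ m) : p ∈ ordIdeal (Fin n) m := by
  induction m with
  | zero => simp [ordIdeal]
  | succ m ih =>
    have hm := ih (isBigO_pow_of_le (Nat.le_succ m) hp)
    rw [mem_ordIdeal] at hm
    have hsub : p - homogeneousComponent m p ∈ ordIdeal (Fin n) (m + 1) := by
      rw [mem_ordIdeal]
      intro α hα
      rw [coeff_sub, coeff_homogeneousComponent]
      split_ifs with h
      · exact sub_self _
      · rw [hm α (by omega), sub_zero]
    have hO : ev (homogeneousComponent m p) =O[𝓝 0] fun z => ‖z‖ ^ (m + 1) := by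
      have := hp.sub (isBigO_ev hsub)
      rw [ev_sub] at this
      simpa using this
    have h0 : ev (homogeneousComponent m p) = 0 := by
      ext z
      have hlim : Tendsto (fun t : ℝ => t • z) (𝓝[>] 0) (𝓝 0) := by
        have : Continuous fun t : ℝ => t • z := by fun_prop
        simpa using (this.tendsto 0).mono_left nhdsWithin_le_nhds
      obtain ⟨c, hc⟩ := (hO.comp_tendsto hlim).bound
      have hle : ∀ᶠ t : ℝ in 𝓝[>] 0,
          ‖ev (homogeneousComponent m p) z‖ ≤ c * ‖z‖ ^ (m + 1) * t := by
        filter_upwards [hc, self_mem_nhdsWithin] with t ht htpos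
        have htpos : 0 < t := htpos
        simp only [Function.comp, ev_smul_homogeneousComponent, norm_mul, norm_pow, norm_norm,
          norm_smul, Complex.norm_real, Real.norm_of_nonneg htpos.le] at ht
        refine le_of_mul_le_mul_left (ht.trans (le_of_eq ?_)) (pow_pos htpos m)
        ring
      have hl : Tendsto (fun t : ℝ => c * ‖z‖ ^ (m + 1) * t) (𝓝[>] 0) (𝓝 0) := by
        have : Continuous fun t : ℝ => c * ‖z‖ ^ (m + 1) * t := by fun_prop
        simpa using (this.tendsto 0).mono_left nhdsWithin_le_nhds
      exact norm_le_zero_iff.1 (ge_of_tendsto hl hle)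
    have := Ideal.add_mem _ hsub (b := homogeneousComponent m p) (by
      rw [mem_ordIdeal]
      exact fun α _ => coeff_eq_zero_of_ev_eq_zero α _ h0)
    rwa [sub_add_cancel] at this

end

/-! ### Wirtinger derivatives and Taylor's formula. -/

section

variable {n : ℕ}

/-- The space of smooth complex functions on the phase space. -/
def smoothFun (n : ℕ) : Submodule ℂ (PhaseSpace n → ℂ) where
  carrier := {f | ContDiff ℝ (⊤ : ℕ∞) f}
  add_mem' hf hg := by
    rw [mem_ofPred_eq] at hf hg ⊢
    exact hf.add hg
  zero_mem' := by
    rw [mem_ofPred_eq]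
    exact contDiff_const
  smul_mem' c _ hf := by
    rw [mem_ofPred_eq] at hf ⊢
    exact hf.const_smul c

theorem contDiff_smoothFun (f : smoothFun n) : ContDiff ℝ (⊤ : ℕ∞) f.1 := by
  obtain ⟨f, hf⟩ := f
  exact hf

theorem differentiableAt_smoothFun (f : smoothFun n) (z : PhaseSpace n) :
    DifferentiableAt ℝ f.1 z :=
  (ContDiff.differentiable (contDiff_smoothFun f) (by simp)) z

/-- The derivative in the direction `v`, as an endomorphism of the space of smooth functions. -/
def dirDeriv (v : PhaseSpace n) : Module.End ℂ (smoothFun n) where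
  toFun f := ⟨fun z => fderiv ℝ f.1 z v,
    ((contDiff_smoothFun f).fderiv_right (m := (⊤ : ℕ∞))
      (by exact_mod_cast le_top)).clm_apply contDiff_const⟩
  map_add' f g := by
    ext z
    simp [fderiv_add (differentiableAt_smoothFun f z) (differentiableAt_smoothFun g z)]
  map_smul' c f := by
    ext z
    simp [fderiv_const_smul (differentiableAt_smoothFun f z)]

/-- Symmetry of the second derivative; it makes the noncommutative product defining `wirtPow`
legitimate. -/
theorem commute_dirDeriv (v w : PhaseSpace n) : Commute (dirDeriv v) (dirDeriv w) := by
  refine LinearMap.ext fun f => Subtype.ext (funext fun z => ?_)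
  have hd : DifferentiableAt ℝ (fderiv ℝ f.1) z :=
    ((contDiff_smoothFun f).fderiv_right (m := (⊤ : ℕ∞))
      (by exact_mod_cast le_top)).differentiable (by simp) z
  have hs : IsSymmSndFDerivAt ℝ f.1 z :=
    ContDiffAt.isSymmSndFDerivAt (ContDiff.contDiffAt (contDiff_smoothFun f))
      (by rw [minSmoothness_of_isRCLikeNormedField]; norm_cast)
  have key : ∀ a b : PhaseSpace n,
      (dirDeriv a (dirDeriv b f)).1 z = fderiv ℝ (fderiv ℝ f.1) z a b := by
    intro a b
    change fderiv ℝ (fun z => fderiv ℝ f.1 z b) z a = _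
    rw [fderiv_clm_apply hd (differentiableAt_const b)]
    simp
  exact (key v w).trans ((hs v w).trans (key w v).symm)

/-- The Wirtinger derivative with respect to `coord i`. -/
def wirt : Fin n ⊕ Fin n → Module.End ℂ (smoothFun n)
  | Sum.inl j => (2 : ℂ)⁻¹ • (dirDeriv (unitVec (Sum.inl j)) +
      (-Complex.I) • dirDeriv (unitVec (Sum.inr j)))
  | Sum.inr j => (2 : ℂ)⁻¹ • (dirDeriv (unitVec (Sum.inl j)) +
      Complex.I • dirDeriv (unitVec (Sum.inr j)))

theorem wirt_apply (i : Fin n ⊕ Fin n) (f : smoothFun n) (z : PhaseSpace n) :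
    (wirt i f).1 z = wirtFun i (fderiv ℝ f.1 z) := by
  rcases i with j | j
  · change (2 : ℂ)⁻¹ * (fderiv ℝ f.1 z _ + (-Complex.I) * fderiv ℝ f.1 z _) = _
    rw [wirtFun_inl]
    ring
  · change (2 : ℂ)⁻¹ * (fderiv ℝ f.1 z _ + Complex.I * fderiv ℝ f.1 z _) = _
    rw [wirtFun_inr]
    ring

theorem commute_wirt (i k : Fin n ⊕ Fin n) : Commute (wirt i) (wirt k) := by
  have h := commute_dirDeriv (n := n)
  have key : ∀ (c d : ℂ) (v w v' w' : PhaseSpace n),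
      Commute ((2 : ℂ)⁻¹ • (dirDeriv v + c • dirDeriv w))
        ((2 : ℂ)⁻¹ • (dirDeriv v' + d • dirDeriv w')) := fun c d v w v' w' =>
    (Commute.smul_right (((h v v').add_right ((h v w').smul_right d)).add_left
      (((h w v').add_right ((h w w').smul_right d)).smul_left c)) _).smul_left _
  rcases i with i | i <;> rcases k with k | k <;> exact key _ _ _ _ _ _

theorem pairwise_commute_wirt (s : Set (Fin n ⊕ Fin n)) (α : Fin n ⊕ Fin n →₀ ℕ) :
    s.Pairwise (Function.onFun Commute fun i => wirt i ^ α i) :=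
  fun i _ k _ _ => (commute_wirt i k).pow_pow _ _

/-- The iterated Wirtinger derivative with multi-index `α`. -/
def wirtPow (α : Fin n ⊕ Fin n →₀ ℕ) : Module.End ℂ (smoothFun n) :=
  Finset.univ.noncommProd (fun i => wirt i ^ α i)
    (pairwise_commute_wirt _ α)

theorem wirtPow_zero : wirtPow (0 : Fin n ⊕ Fin n →₀ ℕ) = 1 := by
  rw [wirtPow, Finset.noncommProd_eq_pow_card _ _ _ 1 (by simp), one_pow]

theorem wirtPow_add_single (α : Fin n ⊕ Fin n →₀ ℕ) (i : Fin n ⊕ Fin n) :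
    wirtPow (α + Finsupp.single i 1) = wirtPow α * wirt i := by
  classical
  have h1 : Finset.univ.noncommProd (fun k => wirt k ^ (Finsupp.single i 1 : _ →₀ ℕ) k)
      (pairwise_commute_wirt _ _) = wirt (n := n) i := by
    rw [← Finset.insert_erase (Finset.mem_univ i),
      Finset.noncommProd_insert_of_notMem _ _ _ _ (Finset.notMem_erase _ _),
      Finset.noncommProd_eq_pow_card _ _ _ 1, one_pow, mul_one, Finsupp.single_eq_same, pow_one]
    intro k hk
    rw [Finsupp.single_eq_of_ne (Finset.ne_of_mem_erase hk), pow_zero]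
  conv_rhs => rw [← h1]
  rw [wirtPow, wirtPow, ← Finset.noncommProd_mul_distrib]
  · exact Finset.noncommProd_congr rfl (fun k _ => by
      simp only [Finsupp.add_apply, pow_add, Pi.mul_apply]) _
  · exact fun k _ l _ _ => (commute_wirt k l).pow_pow _ _

/-- The Taylor series at the origin in the complex coordinates. -/
def taylor (f : smoothFun n) : MvPowerSeries (Fin n ⊕ Fin n) ℂ :=
  fun α => (wirtPow α f).1 0 / ∏ i, ((α i).factorial : ℂ)

theorem coeff_taylor (f : smoothFun n) (α : Fin n ⊕ Fin n →₀ ℕ) :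
    MvPowerSeries.coeff α (taylor f) = (wirtPow α f).1 0 / ∏ i, ((α i).factorial : ℂ) := rfl

/-- Taylor expansion intertwines `wirt i` with the formal derivative, which lets Taylor's formula be
proved by induction on the order. -/
theorem coeff_taylor_wirt (f : smoothFun n) (i : Fin n ⊕ Fin n) (α : Fin n ⊕ Fin n →₀ ℕ) :
    MvPowerSeries.coeff α (taylor (wirt i f)) =
      MvPowerSeries.coeff (α + Finsupp.single i 1) (taylor f) * (α i + 1) := by
  classical
  have hprod : ∏ k, (((α + Finsupp.single i 1 : Fin n ⊕ Fin n →₀ ℕ) k).factorial : ℂ) =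
      (α i + 1) * ∏ k, ((α k).factorial : ℂ) := by
    rw [← Finset.mul_prod_erase _ _ (Finset.mem_univ i),
      ← Finset.mul_prod_erase _ (fun k => ((α k).factorial : ℂ)) (Finset.mem_univ i), ← mul_assoc]
    congr 1
    · simp [Nat.factorial_succ]
    · refine Finset.prod_congr rfl fun k hk => ?_
      rw [Finsupp.add_apply, Finsupp.single_eq_of_ne (Finset.ne_of_mem_erase hk), add_zero]
  have h0 : ((α i : ℂ) + 1) ≠ 0 := Nat.cast_add_one_ne_zero _
  have h1 : ∏ k, ((α k).factorial : ℂ) ≠ 0 :=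
    Finset.prod_ne_zero_iff.2 fun k _ => Nat.cast_ne_zero.2 (Nat.factorial_ne_zero _)
  rw [coeff_taylor, coeff_taylor, hprod, wirtPow_add_single, Module.End.mul_apply]
  field_simp

/-- The Taylor polynomial of degree less than `N`. -/
def taylorPoly (N : ℕ) (f : smoothFun n) : Poly (Fin n) := (taylor f).truncTotal N

theorem coeff_taylorPoly (N : ℕ) (f : smoothFun n) (α : Fin n ⊕ Fin n →₀ ℕ) :
    coeff α (taylorPoly N f) =
      if α.degree < N then MvPowerSeries.coeff α (taylor f) else 0 :=
  MvPowerSeries.coeff_truncTotal_eq_ite ..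

theorem pderiv_taylorPoly (N : ℕ) (f : smoothFun n) (i : Fin n ⊕ Fin n) :
    pderiv i (taylorPoly (N + 1) f) = taylorPoly N (wirt i f) := by
  ext α
  rw [coeff_pderiv, coeff_taylorPoly, coeff_taylorPoly, coeff_taylor_wirt, map_add,
    Finsupp.degree_single]
  simp only [add_lt_add_iff_right]
  split_ifs
  · rfl
  · rw [zero_mul]

theorem isBigO_fderiv_of_wirtFun {f : PhaseSpace n → ℂ} {m : ℕ}
    (hf : ∀ i, (fun z => wirtFun i (fderiv ℝ f z)) =O[𝓝 0] fun z => ‖z‖ ^ m) :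
    fderiv ℝ f =O[𝓝 0] fun z => ‖z‖ ^ m := by
  have : fderiv ℝ f = fun z => ∑ i, wirtFun i (fderiv ℝ f z) • coord i := by
    ext1 z
    exact sum_wirtFun_smul_coord _
  rw [this]
  have hi : ∀ i ∈ Finset.univ, (fun z => wirtFun i (fderiv ℝ f z) • coord i) =O[𝓝 0]
      fun z : PhaseSpace n => ‖z‖ ^ m := by
    intro i _
    refine IsBigO.trans (IsBigO.of_bound ‖(coord i : PhaseSpace n →L[ℝ] ℂ)‖
      (Eventually.of_forall fun z => ?_)) (hf i)
    rw [norm_smul, mul_comm]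
  exact IsBigO.fun_sum hi

/-- Mean value inequality on the ball of radius `‖z‖`. -/
theorem isBigO_of_isBigO_fderiv {E F : Type*} [NormedAddCommGroup E] [NormedSpace ℝ E]
    [NormedAddCommGroup F] [NormedSpace ℝ F] {f : E → F} {m : ℕ} (hd : Differentiable ℝ f)
    (h0 : f 0 = 0) (hf : fderiv ℝ f =O[𝓝 0] fun z => ‖z‖ ^ m) :
    f =O[𝓝 0] fun z => ‖z‖ ^ (m + 1) := by
  obtain ⟨c, hcpos, hc⟩ := hf.exists_pos
  obtain ⟨δ, hδ, hball⟩ := Metric.eventually_nhds_iff_ball.1 hc.bound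
  refine IsBigO.of_bound c ?_
  filter_upwards [Metric.ball_mem_nhds (0 : E) hδ] with z hz
  rw [mem_ball_zero_iff] at hz
  have := (convex_closedBall (0 : E) ‖z‖).norm_image_sub_le_of_norm_fderiv_le
    (𝕜 := ℝ) (f := f) (C := c * ‖z‖ ^ m) (fun x _ => hd x) (fun x hx => ?_)
    (Metric.mem_closedBall_self (norm_nonneg z)) (y := z) (by simp)
  · rw [h0, sub_zero, sub_zero] at this
    refine this.trans (le_of_eq ?_)
    rw [norm_pow, norm_norm]
    ring
  · rw [mem_closedBall_zero_iff] at hx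
    refine (hball x (by rw [mem_ball_zero_iff]; linarith)).trans ?_
    rw [norm_pow, norm_norm]
    gcongr

theorem wirtFun_fderiv_sub_taylorPoly (N : ℕ) (f : smoothFun n) (i : Fin n ⊕ Fin n)
    (z : PhaseSpace n) :
    wirtFun i (fderiv ℝ (f.1 - ev (taylorPoly (N + 1) f)) z) =
      ((wirt i f).1 - ev (taylorPoly N (wirt i f))) z := by
  rw [fderiv_sub (differentiableAt_smoothFun f z) (hasFDerivAt_ev _ z).differentiableAt, map_sub,
    wirtFun_fderiv_ev, pderiv_taylorPoly, Pi.sub_apply, wirt_apply]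

/-- **Taylor's formula** in complex coordinates. -/
theorem isBigO_sub_taylorPoly (N : ℕ) (f : smoothFun n) :
    (f.1 - ev (taylorPoly N f)) =O[𝓝 0] fun z => ‖z‖ ^ N := by
  -- The Wirtinger derivatives of a remainder are the remainders, one order lower, of the functions
  -- `wirt i f`.
  induction N generalizing f with
  | zero =>
    exact isBigO_one_of_continuous
      ((ContDiff.continuous (contDiff_smoothFun f)).sub (contDiff_ev _).continuous)
  | succ N ih =>
    refine isBigO_of_isBigO_fderiv (fun z => (differentiableAt_smoothFun f z).sub
      (hasFDerivAt_ev _ z).differentiableAt) ?_ (isBigO_fderiv_of_wirtFun fun i => ?_)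
    · rw [Pi.sub_apply, ev_apply_zero, coeff_taylorPoly, coeff_taylor, wirtPow_zero]
      simp
    · simp_rw [wirtFun_fderiv_sub_taylorPoly]
      exact ih (wirt i f)

theorem isBigO_wirtFun_sub_taylorPoly (N : ℕ) (f : smoothFun n) (i : Fin n ⊕ Fin n) :
    (fun z => wirtFun i (fderiv ℝ (f.1 - ev (taylorPoly (N + 1) f)) z)) =O[𝓝 0]
      fun z => ‖z‖ ^ N := by
  simp_rw [wirtFun_fderiv_sub_taylorPoly]
  exact isBigO_sub_taylorPoly N (wirt i f)

theorem taylorPoly_sub_mem {N N' : ℕ} (h : N ≤ N') (f : smoothFun n) :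
    taylorPoly N' f - taylorPoly N f ∈ ordIdeal (Fin n) N := by
  rw [mem_ordIdeal]
  intro α hα
  rw [coeff_sub, coeff_taylorPoly, coeff_taylorPoly, if_pos hα, if_pos (hα.trans_le h), sub_self]

end

/-! ### From formal integrals to approximate actions of the smooth system. -/

section

variable {n : ℕ}

/-- A smooth real function, seen as a complex one. -/
def ofRealSmooth (H : PhaseSpace n → ℝ) (hH : ContDiff ℝ (⊤ : ℕ∞) H) : smoothFun n :=
  ⟨fun z => (H z : ℂ), Complex.ofRealCLM.contDiff.comp hH⟩

theorem fderiv_ofRealSmooth {H : PhaseSpace n → ℝ} (hH : ContDiff ℝ (⊤ : ℕ∞) H)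
    (z v : PhaseSpace n) : fderiv ℝ (ofRealSmooth H hH).1 z v = (fderiv ℝ H z v : ℂ) := by
  have h : HasFDerivAt (ofRealSmooth H hH).1 (Complex.ofRealCLM ∘L fderiv ℝ H z) z :=
    Complex.ofRealCLM.hasFDerivAt.comp z ((hH.differentiable (by simp)) z).hasFDerivAt
  rw [h.fderiv]
  rfl

/-- The derivative along the flow is the complex bracket up to the factor `-2i`, the real Poisson
bracket of `q + ip` and `q - ip`. -/
theorem fderiv_ev_hamiltonianVectorField {H : PhaseSpace n → ℝ} (hH : ContDiff ℝ (⊤ : ℕ∞) H)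
    (p : Poly (Fin n)) (z : PhaseSpace n) :
    fderiv ℝ (ev p) z (hamiltonianVectorField H z) = -2 * Complex.I * ∑ j,
      (ev (pderiv (Sum.inl j) p) z * wirtFun (Sum.inr j) (fderiv ℝ (ofRealSmooth H hH).1 z) -
        ev (pderiv (Sum.inr j) p) z * wirtFun (Sum.inl j) (fderiv ℝ (ofRealSmooth H hH).1 z)) := by
  rw [(hasFDerivAt_ev p z).fderiv, sum_apply, Fintype.sum_sum_type, ← Finset.sum_add_distrib,
    Finset.mul_sum]
  refine Finset.sum_congr rfl fun j _ => ?_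
  simp only [smul_apply, smul_eq_mul, coord_inl, coord_inr, wirtFun_inl, wirtFun_inr,
    fderiv_ofRealSmooth, hamiltonianVectorField, Sum.elim_inl, Sum.elim_inr, partialP, partialQ]
  push_cast
  linear_combination ((ev (pderiv (Sum.inl j) p) z + ev (pderiv (Sum.inr j) p) z) *
    (fderiv ℝ H z (unitVec (Sum.inr j)) : ℂ)) * Complex.I_sq

theorem isBigO_fderiv_ev_hamiltonianVectorField {H : PhaseSpace n → ℝ}
    (hH : ContDiff ℝ (⊤ : ℕ∞) H) {N : ℕ} {p : Poly (Fin n)}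
    (hp : poisson p (taylorPoly (N + 1) (ofRealSmooth H hH)) ∈ ordIdeal (Fin n) N) :
    (fun z => fderiv ℝ (ev p) z (hamiltonianVectorField H z)) =O[𝓝 0] fun z => ‖z‖ ^ N := by
  set f := ofRealSmooth H hH
  set h := taylorPoly (N + 1) f
  have hsplit : ∀ i z, wirtFun i (fderiv ℝ f.1 z) =
      ev (pderiv i h) z + wirtFun i (fderiv ℝ (f.1 - ev h) z) := by
    intro i z
    rw [fderiv_sub (differentiableAt_smoothFun f z) (hasFDerivAt_ev _ z).differentiableAt,
      map_sub, wirtFun_fderiv_ev, add_sub_cancel]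
  have hrem : ∀ i k, (fun z => ev (pderiv i p) z * wirtFun k (fderiv ℝ (f.1 - ev h) z)) =O[𝓝 0]
      fun z => ‖z‖ ^ N := by
    intro i k
    have := (isBigO_one_of_continuous (contDiff_ev (pderiv i p)).continuous).mul
      (isBigO_wirtFun_sub_taylorPoly N f k)
    simpa using this
  have hO := (isBigO_ev hp).add (IsBigO.fun_sum (s := Finset.univ) fun j _ =>
    (hrem (Sum.inl j) (Sum.inr j)).sub (hrem (Sum.inr j) (Sum.inl j)))
  refine (hO.const_mul_left (-2 * Complex.I)).congr_left fun z => ?_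
  rw [fderiv_ev_hamiltonianVectorField hH]
  congr 1
  simp only [poisson_apply, ev, map_sum, map_sub, map_mul]
  rw [← Finset.sum_add_distrib]
  refine Finset.sum_congr rfl fun j _ => ?_
  have e1 := hsplit (Sum.inl j) z
  have e2 := hsplit (Sum.inr j) z
  simp only [ev] at e1 e2
  rw [e1, e2]
  ring

theorem ev_actionPoly (j : Fin n) (z : PhaseSpace n) :
    ev (actionPoly j) z = ((2 * action j z : ℝ) : ℂ) := by
  simp only [ev, actionPoly, map_mul, eval_X, coord_inl, coord_inr, action]
  push_cast
  linear_combination (-(z (Sum.inr j) : ℂ) ^ 2) * Complex.I_sq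

theorem ev_oscPoly (ω : Fin n → ℝ) (z : PhaseSpace n) :
    ev (oscPoly ω) z = (harmonicOscillator ω z : ℂ) := by
  have h := fun j => ev_actionPoly j z
  simp only [ev] at h
  simp only [ev, oscPoly, map_sum, smul_eval, h, harmonicOscillator]
  push_cast
  exact Finset.sum_congr rfl fun j _ => by ring

theorem isBigO_harmonicOscillator (ω : Fin n → ℝ) :
    harmonicOscillator ω =O[𝓝 0] fun z => ‖z‖ ^ 2 := by
  refine IsBigO.of_norm_left ((isBigO_ev (oscPoly_mem ω)).norm_left.congr_left fun z => ?_)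
  rw [ev_oscPoly, Complex.norm_real]

theorem taylorPoly_sub_oscPoly_mem {ω : Fin n → ℝ} {H : PhaseSpace n → ℝ}
    (hH : ContDiff ℝ (⊤ : ℕ∞) H)
    (hH3 : (fun z => H z - harmonicOscillator ω z) =O[𝓝 0] fun z => ‖z‖ ^ 3) {N : ℕ}
    (hN : 3 ≤ N) : taylorPoly N (ofRealSmooth H hH) - oscPoly ω ∈ ordIdeal (Fin n) 3 := by
  refine mem_ordIdeal_of_isBigO ?_
  have h1 := isBigO_pow_of_le hN (isBigO_sub_taylorPoly N (ofRealSmooth H hH))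
  have h2 : (fun z => ((H z - harmonicOscillator ω z : ℝ) : ℂ)) =O[𝓝 0]
      fun z : PhaseSpace n => ‖z‖ ^ 3 :=
    IsBigO.of_norm_left (hH3.norm_left.congr_left fun z => (Complex.norm_real _).symm)
  refine (h2.sub h1).congr_left fun z => ?_
  rw [ev_sub, Pi.sub_apply, Pi.sub_apply, ev_oscPoly]
  simp only [ofRealSmooth]
  push_cast
  ring

/-- **Approximate first integrals**: smooth deformations `G_j` of the actions whose derivative
along the Hamiltonian flow vanishes at the origin to any prescribed order. The constant in the
cubic bound on `G_j - I_j` does not depend on the order. -/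
theorem exists_approximate_actions {ω : Fin n → ℝ} (hω : NonResonant ω) {H : PhaseSpace n → ℝ}
    (hH : ContDiff ℝ (⊤ : ℕ∞) H)
    (hH3 : (fun z => H z - harmonicOscillator ω z) =O[𝓝 0] fun z => ‖z‖ ^ 3) :
    ∃ A : ℝ, 0 < A ∧ ∀ N : ℕ, ∃ G : Fin n → PhaseSpace n → ℝ,
      (∀ j, Differentiable ℝ (G j)) ∧
      (∀ j, ∀ᶠ z in 𝓝 0, |G j z - action j z| ≤ A * ‖z‖ ^ 3) ∧
      ∀ j, (fun z => fderiv ℝ (G j) z (hamiltonianVectorField H z)) =O[𝓝 0]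
        fun z => ‖z‖ ^ N := by
  set f := ofRealSmooth H hH
  -- `Ψ` is a reference family of low accuracy whose cubic constants serve for all `N`.
  obtain ⟨Ψ, hΨ, hΨh⟩ := exists_approximate_integrals hω
    (taylorPoly_sub_oscPoly_mem hH hH3 (N := 5) (by norm_num)) 4
  have hb : ∀ j, ∃ c : ℝ, 0 < c ∧ IsBigOWith c (𝓝 0) (ev (Ψ j - actionPoly j))
      fun z => ‖z‖ ^ 3 := fun j => (isBigO_ev (hΨ j)).exists_pos
  choose c hc hcb using hb
  -- The added `1` absorbs `Φ j - Ψ j`, which is `o(‖z‖ ^ 3)`.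
  refine ⟨∑ j, c j + 1, by have := Finset.sum_nonneg fun j (_ : j ∈ Finset.univ) => (hc j).le
                           linarith, fun N => ?_⟩
  -- Accuracy `N + 4` ensures order at least four, so that the cubic parts can be compared with `Ψ`.
  obtain ⟨Φ, hΦ, hΦh⟩ := exists_approximate_integrals hω
    (taylorPoly_sub_oscPoly_mem hH hH3 (N := N + 4 + 1) (by omega)) (N + 4)
  have hdiff : ∀ j, Φ j - Ψ j ∈ ordIdeal (Fin n) 4 := fun j =>
    sub_mem_ordIdeal_four hω (taylorPoly_sub_oscPoly_mem hH hH3 (N := 5) (by norm_num))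
      (ordIdeal_anti (by norm_num) (taylorPoly_sub_mem (N := 5) (by omega) _)) (hΨ j) (hΦ j)
      (hΨh j) (ordIdeal_anti (by omega) (hΦh j))
  have hG : ∀ j z, HasFDerivAt (fun z => (ev (Φ j) z).re / 2)
      ((2 : ℝ)⁻¹ • (Complex.reCLM ∘L fderiv ℝ (ev (Φ j)) z)) z := by
    intro j z
    have h1 := (hasFDerivAt_ev (Φ j) z).differentiableAt.hasFDerivAt
    have h2 := (Complex.reCLM.hasFDerivAt.comp z h1).const_smul (2 : ℝ)⁻¹
    refine h2.congr_of_eventuallyEq (Eventually.of_forall fun w => ?_)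
    simp [div_eq_inv_mul]
  -- The real part is harmless because the vector field is real; the half is there because `ξ_j η_j
  -- = 2 I_j`.
  refine ⟨fun j z => (ev (Φ j) z).re / 2, fun j z => (hG j z).differentiableAt, fun j => ?_,
    fun j => ?_⟩
  · have hlo : ev (Φ j - Ψ j) =o[𝓝 0] fun z => ‖z‖ ^ 3 :=
      (isBigO_ev (hdiff j)).trans_isLittleO (isLittleO_norm_pow_norm_pow (by norm_num))
    filter_upwards [(hcb j).bound, hlo.bound one_pos] with z h1 h2
    have e : (ev (Φ j) z).re / 2 - action j z =
        (ev (Φ j - Ψ j) z + ev (Ψ j - actionPoly j) z).re / 2 := by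
      rw [ev_sub, ev_sub, Pi.sub_apply, Pi.sub_apply, ev_actionPoly, sub_add_sub_cancel,
        Complex.sub_re, Complex.ofReal_re]
      ring
    have h3 := (Complex.abs_re_le_norm (ev (Φ j - Ψ j) z + ev (Ψ j - actionPoly j) z)).trans
      (norm_add_le _ _)
    rw [norm_pow, norm_norm] at h1 h2
    have h4 : c j ≤ ∑ j, c j :=
      Finset.single_le_sum (fun j _ => (hc j).le) (Finset.mem_univ j)
    have h5 : 0 ≤ ‖z‖ ^ 3 := by positivity
    have h6 := mul_le_mul_of_nonneg_right h4 h5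
    have h7 : |(ev (Φ j - Ψ j) z + ev (Ψ j - actionPoly j) z).re / 2| =
        |(ev (Φ j - Ψ j) z + ev (Ψ j - actionPoly j) z).re| / 2 := by
      rw [abs_div, abs_two]
    rw [e, h7]
    have h8 := abs_nonneg (ev (Φ j - Ψ j) z + ev (Ψ j - actionPoly j) z).re
    linarith
  · have h1 := isBigO_pow_of_le (Nat.le_add_right N 4)
      (isBigO_fderiv_ev_hamiltonianVectorField hH (hΦh j))
    refine IsBigO.trans (IsBigO.of_bound 1 (Eventually.of_forall fun z => ?_)) h1
    rw [(hG j z).fderiv, one_mul]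
    simp only [smul_apply, ContinuousLinearMap.comp_apply, Complex.reCLM_apply, smul_eq_mul,
      norm_mul]
    have h2 := Complex.abs_re_le_norm (fderiv ℝ (ev (Φ j)) z (hamiltonianVectorField H z))
    rw [Real.norm_eq_abs, Real.norm_eq_abs]
    norm_num
    have h3 := abs_nonneg (fderiv ℝ (ev (Φ j)) z (hamiltonianVectorField H z)).re
    linarith

end

end

/-! ### Confinement by approximate actions. -/

noncomputable section

variable {n : ℕ}

theorem sq_norm_eq_sum_action (z : PhaseSpace n) : ‖z‖ ^ 2 = 2 * ∑ j, action j z := by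
  rw [EuclideanSpace.norm_sq_eq, Fintype.sum_sum_type, ← Finset.sum_add_distrib, Finset.mul_sum]
  refine Finset.sum_congr rfl fun j _ => ?_
  simp only [action, Real.norm_eq_abs, sq_abs]
  ring

/-- The data of a family of approximate actions for the vector field `X` on the ball of
radius `ρ`. -/
structure ApproxActions (X : PhaseSpace n → PhaseSpace n) (G : Fin n → PhaseSpace n → ℝ)
    (A D ρ : ℝ) (N : ℕ) : Prop where
  differentiable : ∀ j, Differentiable ℝ (G j)
  close : ∀ j z, ‖z‖ ≤ ρ → |G j z - action j z| ≤ A * ‖z‖ ^ 3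
  drift : ∀ j z, ‖z‖ ≤ ρ → |fderiv ℝ (G j) z (X z)| ≤ D * ‖z‖ ^ N

variable {X : PhaseSpace n → PhaseSpace n} {G : Fin n → PhaseSpace n → ℝ} {A D ρ : ℝ} {N : ℕ}

theorem ApproxActions.neg (h : ApproxActions X G A D ρ N) : ApproxActions (-X) G A D ρ N :=
  ⟨h.differentiable, h.close, fun j z hz => by
    simpa only [Pi.neg_apply, map_neg, abs_neg] using h.drift j z hz⟩

/-- While a solution stays in the ball of radius `2ε`, its actions change slowly. -/
theorem ApproxActions.abs_action_sub_le (h : ApproxActions X G A D ρ N) (hA : 0 ≤ A) (hD : 0 ≤ D)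
    {ε t : ℝ} (hε : 0 ≤ ε) (hερ : 2 * ε ≤ ρ) (ht : 0 ≤ t) {γ : ℝ → PhaseSpace n}
    (h0 : ‖γ 0‖ ≤ ε) (hder : ∀ τ ∈ Icc 0 t, HasDerivWithinAt γ (X (γ τ)) (Icc 0 t) τ)
    (hγ : ∀ τ ∈ Icc 0 t, ‖γ τ‖ ≤ 2 * ε) (j : Fin n) :
    |action j (γ t) - action j (γ 0)| ≤ D * (2 * ε) ^ N * t + 9 * A * ε ^ 3 := by
  have h1 : |G j (γ t) - G j (γ 0)| ≤ D * (2 * ε) ^ N * t := by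
    have := norm_image_sub_le_of_norm_deriv_le_segment' (f := fun τ => G j (γ τ))
      (f' := fun τ => fderiv ℝ (G j) (γ τ) (X (γ τ))) (C := D * (2 * ε) ^ N)
      (fun τ hτ => ((h.differentiable j (γ τ)).hasFDerivAt.comp_hasDerivWithinAt τ (hder τ hτ)))
      (fun τ hτ => ?_) t (right_mem_Icc.2 ht)
    · simpa using this
    · have hτ' := hγ τ (Ico_subset_Icc_self hτ)
      refine (h.drift j _ (hτ'.trans hερ)).trans ?_
      gcongr
  -- The two endpoint errors `8 A ε ^ 3` and `A ε ^ 3` make up the `9 A ε ^ 3`.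
  have ht2 := hγ t (right_mem_Icc.2 ht)
  have h2 : |G j (γ t) - action j (γ t)| ≤ A * (2 * ε) ^ 3 :=
    (h.close j _ (ht2.trans hερ)).trans (by gcongr)
  have h3 : |G j (γ 0) - action j (γ 0)| ≤ A * ε ^ 3 :=
    (h.close j _ (by linarith)).trans (by gcongr)
  rw [abs_le] at h1 h2 h3 ⊢
  constructor <;> nlinarith [h1.1, h1.2, h2.1, h2.2, h3.1, h3.2]

/-- The bootstrap argument: a solution issued from the ball of radius `ε` stays in the ball of
radius `2ε`. -/
theorem ApproxActions.norm_le (h : ApproxActions X G A D ρ N) (hA : 0 ≤ A) (hD : 0 ≤ D)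
    {ε T : ℝ} (hε : 0 < ε) (hερ : 2 * ε ≤ ρ)
    (hsmall : 2 * n * (D * (2 * ε) ^ N * T + 9 * A * ε ^ 3) < 3 * ε ^ 2) {γ : ℝ → PhaseSpace n}
    (h0 : ‖γ 0‖ ≤ ε) (hcont : ContinuousOn γ (Icc 0 T))
    (hder : ∀ τ ∈ Icc 0 T, ‖γ τ‖ ≤ 2 * ε → HasDerivWithinAt γ (X (γ τ)) (Icc 0 T) τ) :
    ∀ t ∈ Icc 0 T, ‖γ t‖ ≤ 2 * ε := by
  -- As `‖z‖ ^ 2 = 2 ∑ I_j`, `hsmall` bounds the growth of `‖γ‖ ^ 2` strictly by `3 ε ^ 2`, the gap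
  -- between `ε ^ 2` and `(2 ε) ^ 2`.
  have himprove : ∀ t ∈ Icc 0 T, (∀ τ ∈ Icc 0 t, ‖γ τ‖ ≤ 2 * ε) → ‖γ t‖ < 2 * ε := by
    intro t ht hγ
    have hsub : Icc 0 t ⊆ Icc 0 T := Icc_subset_Icc_right ht.2
    have hj := fun j => (h.abs_action_sub_le hA hD hε.le hερ ht.1 h0
      (fun τ hτ => (hder τ (hsub hτ) (hγ τ hτ)).mono hsub) hγ j)
    have hsum : ∑ j, action j (γ t) - ∑ j, action j (γ 0) ≤
        n * (D * (2 * ε) ^ N * T + 9 * A * ε ^ 3) := by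
      rw [← Finset.sum_sub_distrib]
      have : ∑ j : Fin n, (action j (γ t) - action j (γ 0)) ≤
          ∑ _j : Fin n, (D * (2 * ε) ^ N * T + 9 * A * ε ^ 3) := by
        refine Finset.sum_le_sum fun j _ => (le_abs_self _).trans ((hj j).trans ?_)
        have := ht.2
        gcongr
      rwa [Finset.sum_const, Finset.card_univ, Fintype.card_fin, nsmul_eq_mul] at this
    have e1 := sq_norm_eq_sum_action (γ t)
    have e2 := sq_norm_eq_sum_action (γ 0)
    have e3 : ‖γ 0‖ ^ 2 ≤ ε ^ 2 := by gcongr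
    refine lt_of_pow_lt_pow_left₀ 2 (by positivity) ?_
    nlinarith
  have hnorm : ContinuousOn (fun τ => ‖γ τ‖) (Icc 0 T) := hcont.norm
  have hcross : ∀ t ∈ Icc 0 T, 2 * ε < ‖γ t‖ → ∃ τ ∈ Icc 0 t, ‖γ τ‖ = 2 * ε := fun t ht hlt =>
    intermediate_value_Icc ht.1 (hnorm.mono (Icc_subset_Icc_right ht.2))
      ⟨by linarith, hlt.le⟩
  by_contra! hcon
  obtain ⟨t₁, ht₁, hlt₁⟩ := hcon
  obtain ⟨τ₁, hτ₁, hτ₁e⟩ := hcross t₁ ht₁ hlt₁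
  -- At the first time on the sphere of radius `2ε` the strict improvement gives a contradiction.
  have hcompact : IsCompact (Icc 0 T ∩ (fun τ => ‖γ τ‖) ⁻¹' {2 * ε}) :=
    isCompact_Icc.of_isClosed_subset
      (hnorm.preimage_isClosed_of_isClosed isClosed_Icc isClosed_singleton) inter_subset_left
  obtain ⟨t, ⟨ht, hte⟩, hmin⟩ :=
    hcompact.exists_isLeast ⟨τ₁, ⟨hτ₁.1, hτ₁.2.trans ht₁.2⟩, hτ₁e⟩
  have hte : ‖γ t‖ = 2 * ε := hte
  refine (himprove t ht fun τ hτ => ?_).ne hte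
  by_contra! hlt
  obtain ⟨σ, hσ, hσe⟩ := hcross τ ⟨hτ.1, hτ.2.trans ht.2⟩ hlt
  have hle : t ≤ σ := hmin ⟨⟨hσ.1, hσ.2.trans (hτ.2.trans ht.2)⟩, hσe⟩
  have : τ = t := le_antisymm hτ.2 (hle.trans hσ.2)
  rw [this] at hlt
  exact hlt.ne' hte

/-- Two-sided version of the stability estimate, on any time interval. -/
theorem ApproxActions.stability (h : ApproxActions X G A D ρ N) (hA : 0 ≤ A) (hD : 0 ≤ D)
    {ε : ℝ} (hε : 0 < ε) (hερ : 2 * ε ≤ ρ) {s : Set ℝ} (hs : s.OrdConnected) (hs0 : 0 ∈ s)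
    {γ : ℝ → PhaseSpace n} (h0 : ‖γ 0‖ ≤ ε) (hcont : ContinuousOn γ s)
    (hder : ∀ τ ∈ s, ‖γ τ‖ ≤ 2 * ε → HasDerivWithinAt γ (X (γ τ)) s τ) {t : ℝ} (ht : t ∈ s)
    (hsmall : 2 * n * (D * (2 * ε) ^ N * |t| + 9 * A * ε ^ 3) < 3 * ε ^ 2) :
    ‖γ t‖ ≤ 2 * ε ∧
      ∀ j, |action j (γ t) - action j (γ 0)| ≤ D * (2 * ε) ^ N * |t| + 9 * A * ε ^ 3 := by
  have forward : ∀ {Y : PhaseSpace n → PhaseSpace n} {β : ℝ → PhaseSpace n} {T : ℝ},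
      ApproxActions Y G A D ρ N → 0 ≤ T →
      2 * n * (D * (2 * ε) ^ N * T + 9 * A * ε ^ 3) < 3 * ε ^ 2 → ‖β 0‖ ≤ ε →
      ContinuousOn β (Icc 0 T) →
      (∀ τ ∈ Icc 0 T, ‖β τ‖ ≤ 2 * ε → HasDerivWithinAt β (Y (β τ)) (Icc 0 T) τ) →
      ‖β T‖ ≤ 2 * ε ∧
        ∀ j, |action j (β T) - action j (β 0)| ≤ D * (2 * ε) ^ N * T + 9 * A * ε ^ 3 := by
    intro Y β T hY hT hsm hβ0 hβc hβd
    have hn := hY.norm_le hA hD hε hερ hsm hβ0 hβc hβd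
    exact ⟨hn T (right_mem_Icc.2 hT), hY.abs_action_sub_le hA hD hε.le hερ hT hβ0
      (fun τ hτ => hβd τ hτ (hn τ hτ)) hn⟩
  rcases le_total 0 t with htp | htn
  · rw [abs_of_nonneg htp] at hsmall ⊢
    have hsub : Icc 0 t ⊆ s := hs.out hs0 ht
    exact forward h htp hsmall h0 (hcont.mono hsub)
      fun τ hτ hτn => (hder τ (hsub hτ) hτn).mono hsub
  -- Negative times reduce to positive ones by reversing time, which replaces `X` by `-X`.
  · rw [abs_of_nonpos htn] at hsmall ⊢
    have hmaps : MapsTo (fun τ : ℝ => -τ) (Icc 0 (-t)) s := fun τ hτ =>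
      hs.out ht hs0 ⟨by linarith [hτ.2], by linarith [hτ.1]⟩
    have := forward (β := fun τ => γ (-τ)) h.neg (by linarith) hsmall (by simpa using h0)
      (hcont.comp continuousOn_neg hmaps) fun τ hτ hτn => ?_
    · simpa using this
    · have h1 := (hder (-τ) (hmaps hτ) hτn).scomp τ (hasDerivAt_neg τ).hasDerivWithinAt hmaps
      rw [neg_one_smul] at h1
      exact h1

/-! ### Existence of solutions and localisation of the Hamiltonian. -/

theorem exists_solution_of_lipschitz_of_bounded {E : Type*} [NormedAddCommGroup E]
    [NormedSpace ℝ E] [CompleteSpace E] {v : E → E} {K : NNReal} (hv : LipschitzWith K v)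
    {B : ℝ} (hB : ∀ x, ‖v x‖ ≤ B) (x : E) {T : ℝ} (hT : 0 ≤ T) :
    ∃ γ : ℝ → E, γ 0 = x ∧ IsIntegralCurveOn γ (fun _ => v) (Icc (-T) T) := by
  have hB0 : 0 ≤ B := (norm_nonneg _).trans (hB x)
  lift B to NNReal using hB0
  lift T to NNReal using hT
  -- With speed at most `B`, the radius `B * T` suffices, so one application covers the whole
  -- interval without gluing.
  have hPL : IsPicardLindelof (fun _ => v) (tmin := -T) (tmax := T) ⟨0, by simp⟩ x (B * T) 0 B K :=
    { lipschitzOnWith := fun _ _ => hv.lipschitzOnWith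
      continuousOn := fun _ _ => continuousOn_const
      norm_le := fun _ _ y _ => hB y
      mul_max_le := by simp [NNReal.coe_mul] }
  exact hPL.exists_eq_forall_mem_Icc_hasDerivWithinAt₀

/-- The symplectic gradient of a linear form. -/
def sympGrad (L : PhaseSpace n →L[ℝ] ℝ) : PhaseSpace n :=
  WithLp.toLp 2 (Sum.elim (fun j => L (EuclideanSpace.single (Sum.inr j) 1))
    (fun j => -L (EuclideanSpace.single (Sum.inl j) 1)))

theorem hamiltonianVectorField_eq (H : PhaseSpace n → ℝ) (z : PhaseSpace n) :
    hamiltonianVectorField H z = sympGrad (fderiv ℝ H z) := rfl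

theorem sympGrad_zero : sympGrad (0 : PhaseSpace n →L[ℝ] ℝ) = 0 := by
  ext i
  rcases i with i | i <;> simp [sympGrad]

theorem contDiff_hamiltonianVectorField {H : PhaseSpace n → ℝ} (hH : ContDiff ℝ (⊤ : ℕ∞) H) :
    ContDiff ℝ (⊤ : ℕ∞) (hamiltonianVectorField H) := by
  have hd : ∀ v, ContDiff ℝ (⊤ : ℕ∞) fun z => fderiv ℝ H z v := fun v =>
    (hH.fderiv_right (m := (⊤ : ℕ∞)) (by exact_mod_cast le_top)).clm_apply contDiff_const
  rw [contDiff_euclidean]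
  rintro (j | j)
  · exact hd _
  · exact (hd _).neg

theorem hasCompactSupport_hamiltonianVectorField {H : PhaseSpace n → ℝ}
    (hH : HasCompactSupport H) : HasCompactSupport (hamiltonianVectorField H) :=
  (hH.fderiv ℝ).comp_left sympGrad_zero

theorem contDiff_harmonicOscillator (ω : Fin n → ℝ) :
    ContDiff ℝ (⊤ : ℕ∞) (harmonicOscillator ω) := by
  have : ∀ i, ContDiff ℝ (⊤ : ℕ∞) fun z : PhaseSpace n => z i := fun i =>
    (EuclideanSpace.proj (𝕜 := ℝ) i).contDiff
  refine ContDiff.sum fun j _ => contDiff_const.mul ?_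
  exact (((this _).pow 2).add ((this _).pow 2)).div_const 2

/-- A Hamiltonian that is smooth on a neighbourhood of the origin agrees near the origin with a
smooth one of compact support. -/
theorem exists_smooth_cutoff {M : Set (PhaseSpace n)} (hM : IsOpen M) (h0 : (0 : PhaseSpace n) ∈ M)
    {H : PhaseSpace n → ℝ} (hH : ContDiffOn ℝ (⊤ : ℕ∞) H M) :
    ∃ (H' : PhaseSpace n → ℝ) (ρ : ℝ), 0 < ρ ∧ ContDiff ℝ (⊤ : ℕ∞) H' ∧ HasCompactSupport H' ∧
      ∀ z, ‖z‖ < ρ → z ∈ M ∧ H' =ᶠ[𝓝 z] H := by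
  obtain ⟨R, hR, hball⟩ := Metric.nhds_basis_closedBall.mem_iff.1 (hM.mem_nhds h0)
  let φ : ContDiffBump (0 : PhaseSpace n) := ⟨R / 2, R, by positivity, by linarith⟩
  have hφ : ContDiff ℝ (⊤ : ℕ∞) φ := φ.contDiff
  refine ⟨fun z => φ z * H z, R / 2, by positivity, ?_, ?_, fun z hz => ⟨?_, ?_⟩⟩
  · refine contDiff_iff_contDiffAt.2 fun z => ?_
    by_cases hz : z ∈ tsupport φ
    · rw [φ.tsupport_eq] at hz
      exact hφ.contDiffAt.mul (hH.contDiffAt (hM.mem_nhds (hball hz)))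
    · refine contDiffAt_const (c := (0 : ℝ)) |>.congr_of_eventuallyEq ?_
      filter_upwards [(notMem_tsupport_iff_eventuallyEq.1 hz)] with w hw
      rw [hw, Pi.zero_apply, zero_mul]
  · exact φ.hasCompactSupport.mul_right
  · refine hball ?_
    rw [mem_closedBall_zero_iff]
    linarith
  · have hz' : z ∈ Metric.ball (0 : PhaseSpace n) (R / 2) := mem_ball_zero_iff.2 hz
    filter_upwards [Metric.isOpen_ball.mem_nhds hz'] with w hw
    rw [φ.one_of_mem_closedBall (Metric.ball_subset_closedBall hw), one_mul]

end

/-! ### Uniform constants and the stability theorem. -/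

section

variable {n : ℕ}

theorem hamiltonianVectorField_congr {H H' : PhaseSpace n → ℝ} {z : PhaseSpace n}
    (h : H =ᶠ[𝓝 z] H') : hamiltonianVectorField H z = hamiltonianVectorField H' z := by
  rw [hamiltonianVectorField_eq, hamiltonianVectorField_eq, h.fderiv_eq]

theorem exists_approxActions {X : PhaseSpace n → PhaseSpace n} {G : Fin n → PhaseSpace n → ℝ}
    {A : ℝ} {N : ℕ} (hd : ∀ j, Differentiable ℝ (G j))
    (hclose : ∀ j, ∀ᶠ z in 𝓝 0, |G j z - action j z| ≤ A * ‖z‖ ^ 3)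
    (hdrift : ∀ j, (fun z => fderiv ℝ (G j) z (X z)) =O[𝓝 0] fun z => ‖z‖ ^ N)
    {ρ₀ : ℝ} (hρ₀ : 0 < ρ₀) :
    ∃ D ρ : ℝ, 0 ≤ D ∧ 0 < ρ ∧ ρ < ρ₀ ∧ ApproxActions X G A D ρ N := by
  choose c hc hcb using fun j => (hdrift j).exists_pos
  have hev : ∀ᶠ z in 𝓝 (0 : PhaseSpace n), ∀ j, |G j z - action j z| ≤ A * ‖z‖ ^ 3 ∧
      ‖fderiv ℝ (G j) z (X z)‖ ≤ c j * ‖‖z‖ ^ N‖ :=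
    eventually_all.2 fun j => (hclose j).and (hcb j).bound
  obtain ⟨R, hR, hball⟩ := Metric.nhds_basis_closedBall.eventually_iff.1 hev
  have hin : ∀ z : PhaseSpace n, ‖z‖ ≤ min R (ρ₀ / 2) → z ∈ Metric.closedBall 0 R := fun z hz =>
    mem_closedBall_zero_iff.2 (hz.trans (min_le_left _ _))
  refine ⟨∑ j, c j, min R (ρ₀ / 2), Finset.sum_nonneg fun j _ => (hc j).le,
    lt_min hR (by linarith), (min_le_right _ _).trans_lt (by linarith), hd,
    fun j z hz => (hball (hin z hz) j).1, fun j z hz => ?_⟩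
  have h1 := (hball (hin z hz) j).2
  rw [norm_pow, norm_norm, Real.norm_eq_abs] at h1
  refine h1.trans ?_
  gcongr
  exact Finset.single_le_sum (fun j _ => (hc j).le) (Finset.mem_univ j)

/-- The stability estimate for times of order `ε ^ (1 - r)`. -/
theorem ApproxActions.stability_long_time {X : PhaseSpace n → PhaseSpace n}
    {G : Fin n → PhaseSpace n → ℝ} {A D ρ : ℝ} {r : ℕ} (h : ApproxActions X G A D ρ (r + 2))
    (hr : 1 ≤ r) (hA : 0 ≤ A) (hD : 0 ≤ D) {ε : ℝ} (hε : 0 < ε) (hερ : 2 * ε ≤ ρ)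
    (hsmall : ε * (2 * n * (D * 2 ^ (r + 2) + 9 * A)) < 3)
    {s : Set ℝ} (hs : s.OrdConnected) (hs0 : 0 ∈ s) {γ : ℝ → PhaseSpace n} (h0 : ‖γ 0‖ ≤ ε)
    (hcont : ContinuousOn γ s)
    (hder : ∀ τ ∈ s, ‖γ τ‖ ≤ 2 * ε → HasDerivWithinAt γ (X (γ τ)) s τ) {t : ℝ} (ht : t ∈ s)
    (htime : ε ^ (r - 1) * |t| ≤ 1) :
    ‖γ t‖ ≤ 2 * ε ∧ ∀ j, |action j (γ t) - action j (γ 0)| ≤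
      D * 2 ^ (r + 2) * ε ^ 3 * (ε ^ (r - 1) * |t|) + 9 * A * ε ^ 3 := by
  -- The drift order `r + 2 = 3 + (r - 1)` leaves `ε ^ 3` after integration over times `ε ^ (1 -
  -- r)`.
  have e : D * (2 * ε) ^ (r + 2) * |t| = D * 2 ^ (r + 2) * ε ^ 3 * (ε ^ (r - 1) * |t|) := by
    rw [mul_pow, show ε ^ (r + 2) = ε ^ 3 * ε ^ (r - 1) by rw [← pow_add]; congr 1; omega]
    ring
  rw [← e]
  refine h.stability hA hD hε hερ hs hs0 h0 hcont hder ht ?_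
  have h1 : D * 2 ^ (r + 2) * ε ^ 3 * (ε ^ (r - 1) * |t|) ≤ D * 2 ^ (r + 2) * ε ^ 3 :=
    mul_le_of_le_one_right (by positivity) htime
  have h2 : (0 : ℝ) ≤ 2 * n := by positivity
  calc 2 * n * (D * (2 * ε) ^ (r + 2) * |t| + 9 * A * ε ^ 3)
      ≤ 2 * n * (D * 2 ^ (r + 2) * ε ^ 3 + 9 * A * ε ^ 3) := by
        rw [e]
        gcongr
    _ = ε * (2 * n * (D * 2 ^ (r + 2) + 9 * A)) * ε ^ 2 := by ring
    _ < 3 * ε ^ 2 := mul_lt_mul_of_pos_right hsmall (by positivity)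

end

end BirkhoffFormal

open BirkhoffFormal in
theorem mainTheorem7 {n : ℕ} (ω : Fin n → ℝ) (hω : NonResonant ω)
    (M : Set (PhaseSpace n)) (hM : IsOpen M) (h0 : (0 : PhaseSpace n) ∈ M)
    (P : PhaseSpace n → ℝ) (hP : ContDiffOn ℝ (⊤ : ℕ∞) P M)
    (hP3 : P =O[𝓝 (0 : PhaseSpace n)] fun z => ‖z‖ ^ 3) :
    ∃ K : ℝ, 0 < K ∧ ∀ r : ℕ, 3 ≤ r →
      ∃ ε₀ : ℝ, 0 < ε₀ ∧ ∃ C : ℝ, 0 < C ∧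
        ∀ (z₀ : PhaseSpace n) (ε : ℝ), ‖z₀‖ = ε → ε < ε₀ →
          -- the solution exists in `M` for `|t| ≤ C / ε ^ (r - 1)` (for all `t` when `ε = 0`)
          (∃ γ : ℝ → PhaseSpace n, γ 0 = z₀ ∧
            IsHamiltonianSolutionOn M (fun z => harmonicOscillator ω z + P z) γ
              {t : ℝ | ε ^ (r - 1) * |t| ≤ C}) ∧
          -- and every solution, on any interval around the time `0`, satisfies the two bounds
          ∀ (s : Set ℝ) (γ : ℝ → PhaseSpace n), s.OrdConnected → 0 ∈ s → γ 0 = z₀ →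
            IsHamiltonianSolutionOn M (fun z => harmonicOscillator ω z + P z) γ s →
            (∀ t ∈ s, ε ^ (r - 1) * |t| ≤ C → ‖γ t‖ ≤ 2 * ε) ∧
            (∀ t ∈ s, ε ^ (r - 2) * |t| ≤ C →
              ∀ j : Fin n, |action j (γ t) - action j (γ 0)| ≤ K * ε ^ 3) := by
  set H : PhaseSpace n → ℝ := fun z => harmonicOscillator ω z + P z with hHdef
  obtain ⟨H', ρ₀, hρ₀, hH', hsupp, hloc⟩ := exists_smooth_cutoff hM h0 (H := H)
    ((contDiff_harmonicOscillator ω).contDiffOn.add hP)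
  have hX : ∀ z, ‖z‖ < ρ₀ → hamiltonianVectorField H' z = hamiltonianVectorField H z :=
    fun z hz => hamiltonianVectorField_congr (hloc z hz).2
  have hH3 : (fun z => H' z - harmonicOscillator ω z) =O[𝓝 0] fun z => ‖z‖ ^ 3 := by
    refine hP3.congr' ?_ EventuallyEq.rfl
    filter_upwards [(hloc 0 (by simpa using hρ₀)).2] with z hz
    rw [hz, hHdef]
    ring
  obtain ⟨A, hA, hint⟩ := exists_approximate_actions hω hH' hH3
  -- `K` is chosen before `r`: `9 * A` comes from `|G_j - I_j|`, and `1` absorbs the drift.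
  refine ⟨9 * A + 1, by positivity, fun r hr => ?_⟩
  obtain ⟨G, hGd, hGclose, hGdrift⟩ := hint (r + 2)
  obtain ⟨D, ρ, hD, hρ, hρρ₀, happ⟩ := exists_approxActions hGd hGclose hGdrift hρ₀
  set Q := D * 2 ^ (r + 2) with hQ
  have hQ0 : 0 ≤ Q := by positivity
  -- `ε * W < 1` yields both the confinement condition and `Q * ε ≤ 1`.
  set W := 2 * n * (Q + 9 * A) + Q + 1 with hW
  have hnQ : 0 ≤ 2 * n * (Q + 9 * A) := by positivity
  have hWpos : 0 < W := by positivity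
  have hsmall : ∀ ε : ℝ, 0 < ε → ε < min (min 1 (ρ / 2)) (1 / W) →
      ε < 1 ∧ 2 * ε ≤ ρ ∧ ε * (2 * n * (Q + 9 * A)) < 3 ∧ Q * ε ≤ 1 := by
    intro ε hε hlt
    rw [lt_min_iff, lt_min_iff, lt_div_iff₀ hWpos] at hlt
    obtain ⟨⟨h1, h2⟩, h3⟩ := hlt
    refine ⟨h1, by linarith, ?_, ?_⟩ <;> rw [hW] at h3 <;> nlinarith
  have hsol : ∀ {s : Set ℝ} {γ : ℝ → PhaseSpace n}, IsHamiltonianSolutionOn M H γ s → ∀ ε : ℝ,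
      2 * ε ≤ ρ → ContinuousOn γ s ∧ ∀ τ ∈ s, ‖γ τ‖ ≤ 2 * ε →
        HasDerivWithinAt γ (hamiltonianVectorField H' (γ τ)) s τ := by
    intro s γ hγ ε hε
    refine ⟨fun τ hτ => (hγ.2 τ hτ).continuousWithinAt, fun τ hτ hle => ?_⟩
    rw [hX _ (by linarith)]
    exact hγ.2 τ hτ
  refine ⟨min (min 1 (ρ / 2)) (1 / W), by positivity, 1, one_pos, fun z₀ ε hz₀ hεlt => ?_⟩
  rcases (norm_nonneg z₀).eq_or_lt with hzero | hpos
  · rw [← hzero] at hz₀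
    subst hz₀
    have hz : z₀ = 0 := norm_eq_zero.1 hzero.symm
    subst hz
    refine ⟨⟨fun _ => 0, rfl, fun _ _ => h0, fun t _ => ?_⟩, fun s γ hs hs0 hγ0 hγ => ?_⟩
    · have hd : fderiv ℝ H 0 = 0 := by
        have hO : H =O[𝓝 0] fun z => ‖z - 0‖ ^ 2 := by
          simp only [sub_zero]
          exact (isBigO_harmonicOscillator ω).add (isBigO_pow_of_le (by norm_num) hP3)
        exact (hO.hasFDerivAt (by norm_num)).fderiv
      simp only [hamiltonianVectorField_eq, hd, sympGrad_zero]
      exact hasDerivWithinAt_const _ _ _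
    -- Uniqueness at the equilibrium follows from stability: the solution starts in every ball of
    -- radius `δ`, so `‖γ t‖ ≤ 2δ` for all small `δ`.
    · have hγzero : ∀ t ∈ s, γ t = 0 := by
        intro t ht
        have hlim : Tendsto (fun ε : ℝ => 2 * ε) (𝓝[>] 0) (𝓝 0) := by
          have : Continuous fun ε : ℝ => 2 * ε := by fun_prop
          simpa using (this.tendsto 0).mono_left nhdsWithin_le_nhds
        have htime : ∀ᶠ ε : ℝ in 𝓝[>] 0, ε ^ (r - 1) * |t| < 1 := by
          have : Continuous fun ε : ℝ => ε ^ (r - 1) * |t| := by fun_prop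
          have h := (this.tendsto 0).mono_left (nhdsWithin_le_nhds (s := Ioi 0))
          rw [zero_pow (by omega), zero_mul] at h
          exact h.eventually_lt_const one_pos
        refine norm_le_zero_iff.1 (ge_of_tendsto hlim ?_)
        filter_upwards [htime, self_mem_nhdsWithin,
          nhdsWithin_le_nhds (Iio_mem_nhds hεlt)] with δ hδt hδ hδlt
        obtain ⟨-, h2, h3, -⟩ := hsmall δ hδ hδlt
        obtain ⟨hc, hd⟩ := hsol hγ δ h2
        exact (happ.stability_long_time (by omega) hA.le hD hδ h2 h3 hs hs0
          (by rw [hγ0, norm_zero]; exact le_of_lt hδ) hc hd ht hδt.le).1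
      refine ⟨fun t ht _ => by simp [hγzero t ht], fun t ht _ j => ?_⟩
      rw [hγzero t ht, hγ0]
      simp
  · rw [hz₀] at hpos
    obtain ⟨h1, h2, h3, h4⟩ := hsmall ε hpos hεlt
    refine ⟨?_, fun s γ hs hs0 hγ0 hγ => ?_⟩
    · obtain ⟨Kl, hKl⟩ := ContDiff.lipschitzWith_of_hasCompactSupport
        (hasCompactSupport_hamiltonianVectorField hsupp) (contDiff_hamiltonianVectorField hH')
        (by simp)
      obtain ⟨B, hB⟩ := (hasCompactSupport_hamiltonianVectorField hsupp).exists_bound_of_continuous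
        (contDiff_hamiltonianVectorField hH').continuous
      have hεr : 0 < ε ^ (r - 1) := pow_pos hpos _
      obtain ⟨γ, hγ0, hγ⟩ := exists_solution_of_lipschitz_of_bounded hKl hB z₀
        (T := 1 / ε ^ (r - 1)) (by positivity)
      have hset : {t : ℝ | ε ^ (r - 1) * |t| ≤ 1} = Icc (-(1 / ε ^ (r - 1))) (1 / ε ^ (r - 1)) := by
        ext t
        rw [mem_ofPred_eq, mem_Icc, ← abs_le, le_div_iff₀' hεr]
      -- The solution of the modified system stays where `H'` and `H` agree locally, so it solves
      -- the original one inside `M`.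
      have hbound : ∀ t ∈ Icc (-(1 / ε ^ (r - 1))) (1 / ε ^ (r - 1)), ‖γ t‖ ≤ 2 * ε := by
        intro t ht
        have htime : ε ^ (r - 1) * |t| ≤ 1 := by
          rw [← hset] at ht
          exact ht
        refine (happ.stability_long_time (by omega) hA.le hD hpos h2 h3 ordConnected_Icc
          ?_ (by rw [hγ0, hz₀]) (fun τ hτ => (hγ τ hτ).continuousWithinAt)
          (fun τ hτ _ => hγ τ hτ) ht htime).1
        rw [← hset]
        simp
      refine ⟨γ, hγ0, ?_⟩
      rw [hset]
      refine ⟨fun t ht => (hloc _ (by linarith [hbound t ht])).1, fun t ht => ?_⟩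
      beta_reduce
      rw [← hX _ (by linarith [hbound t ht])]
      exact hγ t ht
    · obtain ⟨hc, hd⟩ := hsol hγ ε h2
      have hstab := fun t ht htime => happ.stability_long_time (t := t) (by omega) hA.le hD hpos h2
        h3 hs hs0 (by rw [hγ0, hz₀]) hc hd ht htime
      refine ⟨fun t ht htime => (hstab t ht htime).1, fun t ht htime j => ?_⟩
      have e : ε ^ (r - 1) * |t| = ε * (ε ^ (r - 2) * |t|) := by
        rw [← mul_assoc, ← pow_succ']
        congr 2
        omega
      -- The shorter time range gains a factor `ε`; the drift is then at most `Q * ε ^ 4 ≤ ε ^ 3`,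
      -- which removes the dependence of `Q` on `r`.
      have hle : ε ^ (r - 1) * |t| ≤ ε := by
        rw [e]
        exact mul_le_of_le_one_right hpos.le htime
      refine ((hstab t ht (hle.trans h1.le)).2 j).trans ?_
      have hε3 : 0 ≤ ε ^ 3 := by positivity
      have h5 : Q * ε ^ 3 * (ε ^ (r - 1) * |t|) ≤ Q * ε ^ 3 * ε := by gcongr
      nlinarith
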